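/- **Setting.** Let $m,d\ge 1$, let $f_1,\dots,f_m:\mathbb R^d\to\mathbb R$ be $C^2$ and $f=\frac1m\sum_{k=1}^m f_k$. Assume that $f$ is $\alpha$-strongly convex ($\alpha>0$) and $\beta$-smooth with minimizer $x^*$, that $\nabla^2 f$ is $M$-Lipschitz (operator norm), and that the components are scaled so that $\nabla^2 f_k(x)\preceq I$ for all $k,x$, i.e. the common curvature bound $\beta_{\max}$ of the components is $1$. With this scaling put $$\hat\kappa_l=\sup_x\frac{1}{\lambda_{\min}(\nabla^2 f(x))},\qquad \hat\kappa_l^{\max}=\sup_x\frac1{\alpha_{\min}(x)},\qquad \alpha_{\min}(x)=\min_k\lambda_{\min}(\nabla^2 f_k(x))>0,$$ and assume $\hat\kappa_l^{\max}<\infty$. One *LiSSA step* from $x$ with parameters $S_1,S_2$ draws indices $k_{i,j}$ ($i\le S_1$, $j\le S_2$) independently and uniformly from $\{1,\dots,m\}$, sets $X_{[i,0]}=\nabla f(x)$ and $X_{[i,j]}=\nabla f(x)+(I-\nabla^2 f_{k_{i,j}}(x))X_{[i,j-1]}$, and returns $x-\frac1{S_1}\sum_{i=1}^{S_1}X_{[i,S_2]}$.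 Let $x_1$ be any warm start (the output of a first-order method) with $4\hat\kappa_l M\,\|x_1-x^*\|\le 1$, and let $x_{t+1}$ be obtained from $x_t$ by a LiSSA step with fresh indices. **Theorem.** There are a universal constant $C>0$ and, for each $A\ge1$, a constant $K_A$ depending only on $A$ (of order $A^2$) such that the following holds. Let $0<\delta<1$ (with $\delta\le\frac12$ if $d=1$), and let the integers $S_1,S_2$ satisfy $S_1\ge C(\hat\kappa_l^{\max})^2\ln(d/\delta)$ and $S_2\ge 2\hat\kappa_l\ln(4\hat\kappa_l)$. 1. *Convergence.* For every $t\ge1$, with probability at least $1-\delta$, $$\|x_{t+1}-x^*\|\le\tfrac12\|x_t-x^*\| ;$$ moreover, for every $T$, this holds for all of the first $T$ steps simultaneously with probability at least $(1-\delta)^T$. 2. *Time per step.* If also $S_1\le A(\hat\kappa_l^{\max})^2\ln(d/\delta)$ and $S_2\le A\,\hat\kappa_l\ln(4\hat\kappa_l)$, then each step is carried out in time at most $$K_A\Big(md+(\hat\kappa_l^{\max})^2\,\hat\kappa_l\,d^2\,\ln\tfrac d\delta\,\ln(4\hat\kappa_l)\Big)=\tilde O\big(md+(\hat\kappa_l^{\max})^2\hat\kappa_l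 d^2\big)$$ by one fixed real-RAM program, in which arithmetic operations, memory accesses and random draws take unit time, and a call that returns $\nabla f_k(x)$ (resp. the matrix $\nabla^2f_k(x)$) takes time $d+O(1)$ (resp. $d^2+O(1)$). 3. *GLM.* If $f_k(x)=\ell_k(\langle v_k,x\rangle)+\frac\lambda2\|x\|^2$ with $C^2$ functions $\ell_k:\mathbb R\to\mathbb R$, where the numbers $v_k$, $\lambda$ are given and an evaluation of $\ell_k'$ or $\ell_k''$ takes constant time, then each step is carried out, also by one fixed program, in time at most $$K_A\Big(md+(\hat\kappa_l^{\max})^2\,\hat\kappa_l\,d\,\ln\tfrac d\delta\,\ln(4\hat\kappa_l)\Big)=\tilde O\big(md+(\hat\kappa_l^{\max})^2\hat\kappa_l d\big).$$ -/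

import Mathlib

open MeasureTheory ProbabilityTheory

noncomputable section

namespace LiSSA

/-! ### Objective, Hessian, condition numbers -/

/-- The Euclidean space `ℝ^d`. -/
abbrev Vec (d : ℕ) : Type := EuclideanSpace ℝ (Fin d)

/-- The Hessian `∇²g(x)`: the derivative of the gradient field. -/
def hess {d : ℕ} (g : Vec d → ℝ) (x : Vec d) : Vec d →L[ℝ] Vec d :=
  fderiv ℝ (gradient g) x

/-- `f(x) = (1/m) ∑ₖ fₖ(x)`. -/
def avg {m d : ℕ} (f : Fin m → Vec d → ℝ) (x : Vec d) : ℝ :=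
  (1 / (m : ℝ)) * ∑ k, f k x

/-- `g` is differentiable, `α`-strongly convex and `β`-smooth. -/
def StronglyConvexSmooth {d : ℕ} (α β : ℝ) (g : Vec d → ℝ) : Prop :=
  Differentiable ℝ g ∧ ∀ x y : Vec d,
    Inner.inner ℝ (gradient g x) (y - x) + α / 2 * ‖y - x‖ ^ 2 ≤ g y - g x ∧
    g y - g x ≤ Inner.inner ℝ (gradient g x) (y - x) + β / 2 * ‖y - x‖ ^ 2

/-- `λ_min(A)`, the smallest eigenvalue (used for symmetric `A` and `d ≥ 1`). -/
def lamMin {d : ℕ} (A : Vec d →L[ℝ] Vec d) : ℝ :=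
  sInf {μ : ℝ | Module.End.HasEigenvalue (A : Vec d →ₗ[ℝ] Vec d) μ}

/-- `α_min(x) = minₖ λ_min(∇²fₖ(x))`. -/
def alphaMin {m d : ℕ} (f : Fin m → Vec d → ℝ) (x : Vec d) : ℝ :=
  ⨅ k, lamMin (hess (f k) x)

/-- `κ̂_l = sup_x β_max / λ_min(∇²f(x))`, for components that are scaled by `∇²fₖ ⪯ I`, so that
the bound `β_max` on the curvature of the components is `1`. -/
def kappaLocal {m d : ℕ} (f : Fin m → Vec d → ℝ) : ℝ :=
  ⨆ x, 1 / lamMin (hess (avg f) x)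

/-- `κ̂_l^max = sup_x β_max / α_min(x)`, with the same scaling `β_max = 1`. -/
def kappaLocalMax {m d : ℕ} (f : Fin m → Vec d → ℝ) : ℝ :=
  ⨆ x, 1 / alphaMin f x

/-! ### The algorithm -/

/-- The inner loop at the point `x`: `X_0 = ∇f(x)` and
`X_j = ∇f(x) + (I - ∇²f_{k_j}(x)) X_{j-1}`, where `k j` is the index drawn in pass `j`
(passes are numbered from `0`). -/
def chain {m d : ℕ} (f : Fin m → Vec d → ℝ) (x : Vec d) (k : ℕ → Fin m) : ℕ → Vec d
  | 0 => gradient (avg f) x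
  | j + 1 => gradient (avg f) x + (chain f x k j - hess (f (k j)) x (chain f x k j))

/-- One step: `x - (1/S₁) ∑ᵢ X_{[i,S₂]}`; `k i j` is the index drawn in pass `j` of chain `i`. -/
def step {m d : ℕ} (f : Fin m → Vec d → ℝ) (S₁ S₂ : ℕ) (x : Vec d) (k : ℕ → ℕ → Fin m) : Vec d :=
  x - (1 / (S₁ : ℝ)) • ∑ i ∈ Finset.range S₁, chain f x (k i) S₂

/-- The points of the Newton phase, started at the warm start `x₁` (which has number `0` here);
`k t i j` is the index drawn in step `t`, chain `i`, pass `j`. -/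
def iter {m d : ℕ} (f : Fin m → Vec d → ℝ) (S₁ S₂ : ℕ) (x₁ : Vec d) (k : ℕ → ℕ → ℕ → Fin m) :
    ℕ → Vec d
  | 0 => x₁
  | t + 1 => step f S₁ S₂ (iter f S₁ S₂ x₁ k t) (k t)

/-- All indices are drawn uniformly from the `m` components and independently. -/
def IsUniformSampling {m : ℕ} {Ω : Type*} [MeasurableSpace Ω] (P : Measure Ω)
    (k : ℕ → ℕ → ℕ → Ω → Fin m) : Prop :=
  (∀ t i j, Measurable (k t i j)) ∧
  iIndepFun (fun q : ℕ × ℕ × ℕ => k q.1 q.2.1 q.2.2) P ∧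
  ∀ t i j r, P.real {ω | k t i j ω = r} = 1 / (m : ℝ)

/-! ### Machine model: a real RAM with an oracle and a step count

A program is a finite piece of syntax. The memory holds integer variables and real arrays.
Every arithmetic operation, memory access, random draw and loop test takes one unit of time, and an
oracle call that writes `n` real numbers takes `n + 1` units. -/

/-- Integer expressions (for addresses and loop bounds). -/
inductive IExp : Type
  | const (n : ℕ)
  | var (v : ℕ)
  | add (a b : IExp)
  | mul (a b : IExp)

/-- Real expressions; `get a i` is entry `i` of array `a`. -/
inductive RExp : Type
  | ofInt (i : IExp)
  | get (a : ℕ) (i : IExp)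
  | add (a b : RExp)
  | sub (a b : RExp)
  | mul (a b : RExp)
  | div (a b : RExp)

/-- Programs over oracles with names in `ι`. -/
inductive Prog (ι : Type) : Type
  /-- entry `i` of array `a` becomes the value of `e` -/
  | assign (a : ℕ) (i : IExp) (e : RExp)
  /-- variable `v` becomes the next random index -/
  | sample (v : ℕ)
  /-- call oracle `o` for component `k` on array `src`, result to array `dst` -/
  | call (o : ι) (k : IExp) (src dst : ℕ)
  /-- one program after the other -/
  | seq (p q : Prog ι)
  /-- run `p` for `v = 0, …, n - 1` -/
  | loop (v : ℕ) (n : IExp) (p : Prog ι)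

/-- What the oracles answer: entry `i` of the answer of oracle `o` for component `k` on an array,
and the number of entries in an answer. -/
structure Oracle (ι : Type) where
  out : ι → ℕ → (ℕ → ℝ) → ℕ → ℝ
  len : ι → ℕ

/-- Machine states; `pos` counts the random draws so far, `time` the units of time so far. -/
structure State where
  ivar : ℕ → ℕ
  arr : ℕ → ℕ → ℝ
  pos : ℕ
  time : ℕ

def IExp.eval (s : State) : IExp → ℕ
  | .const n => n
  | .var v => s.ivar v
  | .add a b => a.eval s + b.eval s
  | .mul a b => a.eval s * b.eval s

/-- The time to evaluate an expression: the number of its nodes. -/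
def IExp.cost : IExp → ℕ
  | .const _ => 1
  | .var _ => 1
  | .add a b => a.cost + b.cost + 1
  | .mul a b => a.cost + b.cost + 1

def RExp.eval (s : State) : RExp → ℝ
  | .ofInt i => (i.eval s : ℝ)
  | .get a i => s.arr a (i.eval s)
  | .add a b => a.eval s + b.eval s
  | .sub a b => a.eval s - b.eval s
  | .mul a b => a.eval s * b.eval s
  | .div a b => a.eval s / b.eval s

def RExp.cost : RExp → ℕ
  | .ofInt i => i.cost + 1
  | .get _ i => i.cost + 1
  | .add a b => a.cost + b.cost + 1
  | .sub a b => a.cost + b.cost + 1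
  | .mul a b => a.cost + b.cost + 1
  | .div a b => a.cost + b.cost + 1

def State.setVar (s : State) (v n : ℕ) : State :=
  { s with ivar := Function.update s.ivar v n }

def State.setEntry (s : State) (a i : ℕ) (r : ℝ) : State :=
  { s with arr := Function.update s.arr a (Function.update (s.arr a) i r) }

def State.tick (s : State) (n : ℕ) : State :=
  { s with time := s.time + n }

/-- Execution of a program, with the random indices read off the tape `ω`. -/
def Prog.run {ι : Type} (O : Oracle ι) (ω : ℕ → ℕ) : Prog ι → State → State
  | .assign a i e, s => (s.setEntry a (i.eval s) (e.eval s)).tick (i.cost + e.cost + 1)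
  | .sample v, s => { (s.setVar v (ω s.pos)).tick 1 with pos := s.pos + 1 }
  | .call o k src dst, s =>
      { s with
        arr := Function.update s.arr dst (fun i =>
          if i < O.len o then O.out o (k.eval s) (s.arr src) i else s.arr dst i)
        time := s.time + (k.cost + O.len o + 1) }
  | .seq p q, s => q.run O ω (p.run O ω s)
  | .loop v n p, s =>
      (List.range (n.eval s)).foldl (fun s' j => p.run O ω ((s'.setVar v j).tick 1))
        (s.tick (n.cost + 1))

/-- The first `d` entries of an array as a vector. -/
def toVec (d : ℕ) (a : ℕ → ℝ) : Vec d := WithLp.toLp 2 (fun i => a i)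

/-- A vector as an array, padded by zeros. -/
def ofVec {d : ℕ} (x : Vec d) (i : ℕ) : ℝ := if h : i < d then x ⟨i, h⟩ else 0

/-- Start of a step: variables `0, 1, 2, 3` hold `m, d, S₁, S₂`, array `0` holds the point `x`,
arrays `1, 2` hold the data; everything else is zero. -/
def initState {d : ℕ} (m S₁ S₂ : ℕ) (x : Vec d) (data₁ data₂ : ℕ → ℝ) : State where
  ivar v := if v = 0 then m else if v = 1 then d else if v = 2 then S₁ else if v = 3 then S₂ else 0
  arr a := if a = 0 then ofVec x else if a = 1 then data₁ else if a = 2 then data₂ else fun _ => 0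
  pos := 0
  time := 0

/-- Oracles for a general objective: the gradient and the Hessian of one component at a point. -/
inductive GeneralOracle : Type
  | grad
  | hess

/-- The gradient of a component is a list of `d` numbers; the Hessian is a `d × d` matrix, with
entry `(i, j)` at place `i * d + j`. -/
def generalOracle {m d : ℕ} (f : Fin m → Vec d → ℝ) : Oracle GeneralOracle where
  out o k a n := if hk : k < m then
      match o with
      | .grad => ofVec (gradient (f ⟨k, hk⟩) (toVec d a)) n
      | .hess =>
          if hj : n % d < d then
            ofVec (hess (f ⟨k, hk⟩) (toVec d a) (EuclideanSpace.single ⟨n % d, hj⟩ 1)) (n / d)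
          else 0
    else 0
  len o := match o with
    | .grad => d
    | .hess => d * d

/-- `f` is the objective of a generalized linear model: `fₖ(x) = ℓₖ(⟨vₖ, x⟩) + (lam/2) ‖x‖²`, with
twice continuously differentiable scalar losses `ℓₖ`. -/
def IsGLM {m d : ℕ} (f : Fin m → Vec d → ℝ) (ℓ : Fin m → ℝ → ℝ) (v : Fin m → Vec d) (lam : ℝ) :
    Prop :=
  (∀ k, ContDiff ℝ 2 (ℓ k)) ∧
  ∀ k x, f k x = ℓ k (Inner.inner ℝ (v k) x) + lam / 2 * ‖x‖ ^ 2

/-- Oracles for a generalized linear model: `ℓₖ'` and `ℓₖ''` at one real number. -/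
inductive GLMOracle : Type
  | deriv
  | deriv2

/-- The argument is entry `0` of the array; the answer is one number. -/
def glmOracle {m : ℕ} (ℓ : Fin m → ℝ → ℝ) : Oracle GLMOracle where
  out o k a _ := if hk : k < m then
      match o with
      | .deriv => _root_.deriv (ℓ ⟨k, hk⟩) (a 0)
      | .deriv2 => _root_.deriv (_root_.deriv (ℓ ⟨k, hk⟩)) (a 0)
    else 0
  len _ := 1

/-- The data vectors, coordinate `i` of `vₖ` at place `k * d + i`. -/
def glmData {m d : ℕ} (v : Fin m → Vec d) (n : ℕ) : ℝ :=
  if hk : n / d < m then ofVec (v ⟨n / d, hk⟩) (n % d) else 0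

/-- `s` is a correct final state of one step within time `B`: array `0` holds the next point, where
pass `j` of chain `i` uses the index in cell `i * S₂ + j` of the random tape. -/
def StepDone {m d : ℕ} (f : Fin m → Vec d → ℝ) (S₁ S₂ : ℕ) (x : Vec d) (ω : ℕ → Fin m)
    (s : State) (B : ℝ) : Prop :=
  toVec d (s.arr 0) = step f S₁ S₂ x (fun i j => ω (i * S₂ + j)) ∧ (s.time : ℝ) ≤ B

end LiSSA

end

/-! A step is a stochastic Newton step, and its error splits into bias and noise. Put `e = x - xs`,
`D = ‖e‖`, `g = ∇f(x)`, `H = ∇²f(x)`. Since the draws in a chain are independent, the mean of a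
chain follows `μ ↦ g + (1 - H) μ`, a contraction with factor `1 - 1/κ` for `κ = kappaLocal f`. The
vector `e` is nearly its fixed point, because `‖H e - g‖ ≤ M D²`. With `4 κ M D ≤ 1` and the choice
of `S₂` the bias is at most `D/16 + D/4 ≤ 3D/8` (`norm_sub_mean_chainFin_le`).

Every chain is bounded by `kappaLocalMax f * D`, so the noise is a mean of `S₁` independent centred
bounded vectors. Its exponential moment is bounded without dependence on the dimension: in a Hilbert
space `cosh ‖·‖` grows by at most the factor `cosh c` per centred summand whose values have mutual
distances at most `c` (`mean_cosh_norm_add_le`). Hence for `p` of order `log (d/δ)` the `p`-th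
moment of `2‖x⁺ - xs‖` is at most `δ/2 * D^p` (`mean_pow_stepFin_le_of_near`).

A moment is used instead of a tail bound because step `t` alone must succeed with probability `1 -
δ`, uniformly in `t`, while the estimate needs the iterate to be in the region `4 κ M ‖x - xs‖ ≤ 1`.
A union bound over the earlier steps would lose a factor `t`. The moment, however, contracts by
`δ/4` per step inside the region, so the probabilities of leaving it sum geometrically to at most
`δ/2` (`prob_not_stays_le`); the step itself costs another `δ/2`. For all steps together no such
bookkeeping is needed, since halving keeps the iterate in the region. Only finitely many uniform
indices enter each event, so all averages are finite means (`measureReal_eq_prob`).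

The running time is counted on explicit programs whose loop bounds are only `m`, `d`, `S₁`, `S₂`, so
it is an explicit polynomial in these. A pass costs order `d²` with a full Hessian and order `d`
with the rank-one-plus-scalar Hessian of a GLM. -/

namespace LiSSA

/-! ### Frame rules for programs -/

/-- The arrays a program may write to. -/
def Prog.arrs {ι : Type} : Prog ι → List ℕ
  | .assign a _ _ => [a]
  | .sample _ => []
  | .call _ _ _ dst => [dst]
  | .seq p q => p.arrs ++ q.arrs
  | .loop _ _ p => p.arrs

/-- The integer variables a program may write to. -/
def Prog.vars {ι : Type} : Prog ι → List ℕ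
  | .assign _ _ _ => []
  | .sample v => [v]
  | .call _ _ _ _ => []
  | .seq p q => p.vars ++ q.vars
  | .loop v _ p => v :: p.vars

/-- The program contains no random draw. -/
def Prog.Deterministic {ι : Type} : Prog ι → Prop
  | .assign _ _ _ => True
  | .sample _ => False
  | .call _ _ _ _ => True
  | .seq p q => p.Deterministic ∧ q.Deterministic
  | .loop _ _ p => p.Deterministic

/-- The variables `0, 1, 2, 3` are never written, and all loop bounds are among them. -/
def Prog.Static {ι : Type} : Prog ι → Prop
  | .assign _ _ _ => True
  | .sample v => 4 ≤ v
  | .call _ _ _ _ => True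
  | .seq p q => p.Static ∧ q.Static
  | .loop v n p => 4 ≤ v ∧ (∃ u < 4, n = .var u) ∧ p.Static

/-- The running time of a static program, where `ρ` gives the values of the variables. -/
def Prog.timeOf {ι : Type} (O : Oracle ι) (ρ : ℕ → ℕ) : Prog ι → ℕ
  | .assign _ i e => i.cost + e.cost + 1
  | .sample _ => 1
  | .call o k _ _ => k.cost + O.len o + 1
  | .seq p q => p.timeOf O ρ + q.timeOf O ρ
  | .loop _ n p => n.cost + 1 + n.eval ⟨ρ, 0, 0, 0⟩ * (1 + p.timeOf O ρ)

section Frame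

variable {ι : Type} (O : Oracle ι) (ω : ℕ → ℕ)

/-- The basic loop rule, by induction on the fold; the other facts about loops are derived from it.
The bound `n` is evaluated once, on entry. -/
theorem run_loop_induct {v : ℕ} {n : IExp} {p : Prog ι} {s : State} (I : ℕ → State → Prop)
    (h0 : I 0 (s.tick (n.cost + 1)))
    (hs : ∀ j < n.eval s, ∀ s', I j s' → I (j + 1) (p.run O ω ((s'.setVar v j).tick 1))) :
    I (n.eval s) ((Prog.loop v n p).run O ω s) := by
  have key : ∀ N ≤ n.eval s, I N ((List.range N).foldl
      (fun s' j => p.run O ω ((s'.setVar v j).tick 1)) (s.tick (n.cost + 1))) := by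
    intro N
    induction N with
    | zero => intro _; simpa using h0
    | succ N ih =>
      intro hN
      rw [List.range_succ, List.foldl_append]
      exact hs N hN _ (ih (by omega))
  exact key _ le_rfl

theorem run_seq (p q : Prog ι) (s : State) :
    (Prog.seq p q).run O ω s = q.run O ω (p.run O ω s) := rfl

theorem run_arr {p : Prog ι} {a : ℕ} (ha : a ∉ p.arrs) (s : State) :
    (p.run O ω s).arr a = s.arr a := by
  induction p generalizing s with
  | assign b i e =>
    simp only [Prog.arrs, List.mem_singleton] at ha
    simp [Prog.run, State.tick, State.setEntry, Function.update_of_ne ha]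
  | sample v => rfl
  | call o k src dst =>
    simp only [Prog.arrs, List.mem_singleton] at ha
    simp [Prog.run, Function.update_of_ne ha]
  | seq p q hp hq =>
    simp only [Prog.arrs, List.mem_append, not_or] at ha
    simp only [Prog.run]
    rw [hq ha.2, hp ha.1]
  | loop v n p hp =>
    refine run_loop_induct O ω (fun _ s' => s'.arr a = s.arr a) rfl fun j _ s' h => ?_
    rw [hp ha]
    exact h

theorem run_ivar {p : Prog ι} {v : ℕ} (hv : v ∉ p.vars) (s : State) :
    (p.run O ω s).ivar v = s.ivar v := by
  induction p generalizing s with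
  | assign b i e => rfl
  | sample u =>
    simp only [Prog.vars, List.mem_singleton] at hv
    simp [Prog.run, State.tick, State.setVar, Function.update_of_ne hv]
  | call o k src dst => rfl
  | seq p q hp hq =>
    simp only [Prog.vars, List.mem_append, not_or] at hv
    simp only [Prog.run]
    rw [hq hv.2, hp hv.1]
  | loop u n p hp =>
    simp only [Prog.vars, List.mem_cons, not_or] at hv
    refine run_loop_induct O ω (fun _ s' => s'.ivar v = s.ivar v) rfl fun j _ s' h => ?_
    rw [hp hv.2]
    simpa [State.tick, State.setVar, Function.update_of_ne hv.1] using h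

theorem run_pos {p : Prog ι} (hp : p.Deterministic) (s : State) :
    (p.run O ω s).pos = s.pos := by
  induction p generalizing s with
  | assign b i e => rfl
  | sample u => exact hp.elim
  | call o k src dst => rfl
  | seq p q ihp ihq =>
    simp only [Prog.run]
    rw [ihq hp.2, ihp hp.1]
  | loop u n p ih =>
    refine run_loop_induct O ω (fun _ s' => s'.pos = s.pos) rfl fun j _ s' h => ?_
    rw [ih hp]
    exact h

theorem Prog.Static.not_mem_vars {p : Prog ι} (hp : p.Static) {v : ℕ} (hv : v < 4) :
    v ∉ p.vars := by
  induction p with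
  | assign b i e => simp [Prog.vars]
  | sample u =>
    have : 4 ≤ u := hp
    simp only [Prog.vars, List.mem_singleton]
    omega
  | call o k src dst => simp [Prog.vars]
  | seq p q ihp ihq => simp [Prog.vars, ihp hp.1, ihq hp.2]
  | loop u n p ih =>
    have : 4 ≤ u := hp.1
    simp only [Prog.vars, List.mem_cons, not_or]
    exact ⟨by omega, ih hp.2.2⟩

/-- No loop bound can change during the run and no branch depends on data. Hence correctness and
time can be treated separately, and the time is found by evaluating `timeOf`. -/
theorem run_time {p : Prog ι} (hp : p.Static) {s : State} {ρ : ℕ → ℕ}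
    (hs : ∀ v < 4, s.ivar v = ρ v) :
    (p.run O ω s).time = s.time + p.timeOf O ρ := by
  induction p generalizing s with
  | assign b i e => rfl
  | sample u => rfl
  | call o k src dst => rfl
  | seq p q ihp ihq =>
    simp only [Prog.run, Prog.timeOf]
    rw [ihq hp.2, ihp hp.1 hs, add_assoc]
    intro v hv
    rw [run_ivar O ω (hp.1.not_mem_vars hv), hs v hv]
  | loop u n p ih =>
    obtain ⟨hu, ⟨w, hw, rfl⟩, hp⟩ := hp
    have := run_loop_induct O ω (s := s) (n := .var w) (v := u) (p := p)
      (fun j s' => s'.time = s.time + (1 + 1) + j * (1 + p.timeOf O ρ) ∧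
        ∀ v < 4, s'.ivar v = ρ v) ⟨by simp [State.tick, IExp.cost], hs⟩ (by
      rintro j _ s' ⟨h1, h2⟩
      have h3 : ∀ v < 4, ((s'.setVar u j).tick 1).ivar v = ρ v := by
        intro v hv
        have : v ≠ u := by omega
        simpa [State.tick, State.setVar, Function.update_of_ne this] using h2 v hv
      refine ⟨?_, fun v hv => ?_⟩
      · rw [ih hp h3]
        simp only [State.tick, State.setVar, h1]
        ring
      · rw [run_ivar O ω (hp.not_mem_vars hv), h3 v hv])
    rw [this.1]
    simp only [Prog.timeOf, IExp.eval, IExp.cost, hs w hw]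
    ring

/-- Loop rule: an invariant of the memory and the tape position, with the frame conditions
available in the step. -/
theorem run_loop_frame {v : ℕ} {n : IExp} {p : Prog ι} {s : State}
    (I : ℕ → (ℕ → ℕ → ℝ) → ℕ → Prop) (h0 : I 0 s.arr s.pos)
    (hs : ∀ j < n.eval s, ∀ s' : State, s'.ivar v = j →
      (∀ a, a ∉ p.arrs → s'.arr a = s.arr a) →
      (∀ u, u ∉ v :: p.vars → s'.ivar u = s.ivar u) →
      I j s'.arr s'.pos → I (j + 1) (p.run O ω s').arr (p.run O ω s').pos) :
    I (n.eval s) ((Prog.loop v n p).run O ω s).arr ((Prog.loop v n p).run O ω s).pos := by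
  refine (run_loop_induct O ω (fun j s' => I j s'.arr s'.pos ∧
      (∀ a, a ∉ p.arrs → s'.arr a = s.arr a) ∧
      (∀ u, u ∉ v :: p.vars → s'.ivar u = s.ivar u)) ⟨h0, fun _ _ => rfl, fun _ _ => rfl⟩ ?_).1
  rintro j hj s' ⟨h1, h2, h3⟩
  have h4 : ∀ u, u ∉ v :: p.vars → ((s'.setVar v j).tick 1).ivar u = s.ivar u := by
    intro u hu
    have : u ≠ v := by
      rintro rfl
      simp at hu
    simpa [State.tick, State.setVar, Function.update_of_ne this] using h3 u hu
  refine ⟨hs j hj _ (by simp [State.tick, State.setVar]) h2 h4 h1, fun a ha => ?_,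
    fun u hu => ?_⟩
  · rw [run_arr O ω ha]
    exact h2 a ha
  · rw [run_ivar O ω (by simp at hu; exact hu.2), h4 u hu]

/-- A loop that overwrites the entries of an array one after the other. -/
theorem run_loop_assign {v a u : ℕ} {e : RExp} {s : State} (r : ℕ → ℝ)
    (he : ∀ i < s.ivar u, ∀ s' : State, s'.ivar v = i → (∀ b, b ≠ a → s'.arr b = s.arr b) →
      (∀ w, w ≠ v → s'.ivar w = s.ivar w) → s'.arr a i = s.arr a i → e.eval s' = r i)
    {i : ℕ} (hi : i < s.ivar u) :
    ((Prog.loop v (.var u) (.assign a (.var v) e)).run O ω s).arr a i = r i := by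
  refine (run_loop_frame O ω (n := .var u) (v := v) (p := .assign a (.var v) e) (s := s)
    (fun j A _ => (∀ i < j, A a i = r i) ∧ ∀ i, j ≤ i → A a i = s.arr a i)
    ⟨by simp, by simp⟩ ?_).1 i hi
  rintro j hj s' h1 h2 h3 ⟨h4, h5⟩
  have hval := he j hj s' h1 (fun b hb => h2 b (by simpa [Prog.arrs] using hb))
    (fun w hw => h3 w (by simpa [Prog.vars] using hw)) (h5 j le_rfl)
  simp only [Prog.run, State.tick, State.setEntry, IExp.eval, h1, Function.update_self, hval]
  refine ⟨fun i hi => ?_, fun i hi => ?_⟩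
  · rcases eq_or_ne i j with rfl | hij
    · simp
    · rw [Function.update_of_ne hij]
      exact h4 i (by omega)
  · rw [Function.update_of_ne (by omega)]
    exact h5 i (by omega)

/-- A loop that accumulates a sum in one entry of an array. -/
theorem run_loop_sum {v a u c : ℕ} {i : IExp} {e : RExp} {s : State} (r : ℕ → ℝ)
    (hi : ∀ s' : State, (∀ w, w ≠ v → s'.ivar w = s.ivar w) → i.eval s' = c)
    (he : ∀ j < s.ivar u, ∀ s' : State, s'.ivar v = j → (∀ b, b ≠ a → s'.arr b = s.arr b) →
      (∀ w, w ≠ v → s'.ivar w = s.ivar w) → e.eval s' = s'.arr a c + r j) :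
    ((Prog.loop v (.var u) (.assign a i e)).run O ω s).arr a =
      Function.update (s.arr a) c (s.arr a c + ∑ j ∈ Finset.range (s.ivar u), r j) := by
  refine run_loop_frame O ω (n := .var u) (v := v) (p := .assign a i e) (s := s)
    (fun j A _ => A a = Function.update (s.arr a) c (s.arr a c + ∑ j ∈ Finset.range j, r j))
    (by simp) ?_
  rintro j hj s' h1 h2 h3 h4
  have h5 : ∀ w, w ≠ v → s'.ivar w = s.ivar w :=
    fun w hw => h3 w (by simpa [Prog.vars] using hw)
  have hval := he j hj s' h1 (fun b hb => h2 b (by simpa [Prog.arrs] using hb)) h5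
  simp only [Prog.run, State.tick, State.setEntry, hi s' h5, Function.update_self, hval, h4,
    Function.update_idem, Finset.sum_range_succ, add_assoc]

end Frame

/-! ### The outer loops of a step -/

theorem toVec_apply {d : ℕ} (a : ℕ → ℝ) (i : Fin d) : toVec d a i = a i := rfl

theorem toVec_congr {d : ℕ} {a b : ℕ → ℝ} (h : ∀ i < d, a i = b i) : toVec d a = toVec d b := by
  ext i
  exact h i i.2

theorem toVec_ofVec {d : ℕ} (x : Vec d) : toVec d (ofVec x) = x := by
  ext i
  simp [toVec, ofVec]

/-- One step, given a program `grad` that computes `∇f(x)` in array `3`, and a program `pass` that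
performs one pass of the inner loop on array `5`. Array `7` accumulates the ends of the chains. -/
def stepProg {ι : Type} (grad pass : Prog ι) : Prog ι :=
  .seq grad <| .seq
    (.loop 5 (.var 2) <| .seq (.loop 7 (.var 1) (.assign 5 (.var 7) (.get 3 (.var 7)))) <|
      .seq (.loop 6 (.var 3) pass)
        (.loop 7 (.var 1)
          (.assign 7 (.var 7) (.add (.get 7 (.var 7)) (.get 5 (.var 7))))))
    (.loop 7 (.var 1)
      (.assign 0 (.var 7) (.sub (.get 0 (.var 7)) (.div (.get 7 (.var 7)) (.ofInt (.var 2))))))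

/-- The state agrees with the initial state of a step on the sizes and on the input data. -/
def InputIntact {d : ℕ} (m S₁ S₂ : ℕ) (x : Vec d) (data₁ data₂ : ℕ → ℝ) (s : State) : Prop :=
  (∀ v < 4, s.ivar v = (initState m S₁ S₂ x data₁ data₂).ivar v) ∧
  ∀ a < 3, s.arr a = (initState m S₁ S₂ x data₁ data₂).arr a

theorem InputIntact.run {ι : Type} {O : Oracle ι} {ω : ℕ → ℕ} {p : Prog ι} {d m S₁ S₂ : ℕ}
    {x : Vec d} {data₁ data₂ : ℕ → ℝ} {s : State} (h : InputIntact m S₁ S₂ x data₁ data₂ s)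
    (hv : p.Static) (ha : ∀ a < 3, a ∉ p.arrs) :
    InputIntact m S₁ S₂ x data₁ data₂ (p.run O ω s) :=
  ⟨fun v hv4 => (run_ivar O ω (hv.not_mem_vars hv4) s).trans (h.1 v hv4),
    fun a ha3 => (run_arr O ω (ha a ha3) s).trans (h.2 a ha3)⟩

theorem InputIntact.frame {d m S₁ S₂ : ℕ} {x : Vec d} {data₁ data₂ : ℕ → ℝ} {s s' : State}
    (h : InputIntact m S₁ S₂ x data₁ data₂ s) (hv : ∀ v < 4, s'.ivar v = s.ivar v)
    (ha : ∀ a < 3, s'.arr a = s.arr a) : InputIntact m S₁ S₂ x data₁ data₂ s' :=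
  ⟨fun v hv4 => (hv v hv4).trans (h.1 v hv4), fun a ha3 => (ha a ha3).trans (h.2 a ha3)⟩

/-- The two cost models differ only in how the gradient and a single pass are computed, so
correctness of the surrounding loops is proved once. Each pass draws exactly one index, which puts
pass `j` of chain `i` at tape cell `i * S₂ + j`. -/
theorem run_stepProg {ι : Type} {O : Oracle ι} {grad pass : Prog ι} {m d : ℕ}
    {f : Fin m → Vec d → ℝ} {S₁ S₂ : ℕ} {x : Vec d} {data₁ data₂ : ℕ → ℝ} {ω : ℕ → Fin m}
    (hgs : grad.Static) (hgd : grad.Deterministic) (hga : ∀ a ∈ [0, 1, 2, 7], a ∉ grad.arrs)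
    (hps : pass.Static)
    (hpa : ∀ a ∈ [0, 1, 2, 3, 7], a ∉ pass.arrs)
    (hgrad : toVec d ((grad.run O (fun n => ω n) (initState m S₁ S₂ x data₁ data₂)).arr 3) =
      gradient (avg f) x)
    (hpass : ∀ s : State, InputIntact m S₁ S₂ x data₁ data₂ s →
      toVec d ((pass.run O (fun n => ω n) s).arr 5) = toVec d (s.arr 3) +
        (toVec d (s.arr 5) - hess (f (ω s.pos)) x (toVec d (s.arr 5))) ∧
      (pass.run O (fun n => ω n) s).pos = s.pos + 1) :
    toVec d (((stepProg grad pass).run O (fun n => ω n)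
      (initState m S₁ S₂ x data₁ data₂)).arr 0) = step f S₁ S₂ x (fun i j => ω (i * S₂ + j)) := by
  set τ : ℕ → ℕ := fun n => ω n
  set s₀ := initState m S₁ S₂ x data₁ data₂ with hs₀
  have hin₀ : InputIntact m S₁ S₂ x data₁ data₂ s₀ := ⟨fun _ _ => rfl, fun _ _ => rfl⟩
  have hin₁ := hin₀.run (O := O) (ω := τ) hgs (fun a ha => hga a (by interval_cases a <;> simp))
  rw [stepProg, run_seq, run_seq]
  set s₁ := grad.run O τ s₀ with hs₁
  -- The accumulator is never cleared: it starts as zero and `grad` does not write to it.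
  have h7 : s₁.arr 7 = fun _ => 0 := by
    rw [hs₁, run_arr O τ (hga 7 (by simp))]
    rfl
  have hpos : s₁.pos = 0 := run_pos O τ hgd s₀
  set body : Prog ι := .seq (.loop 7 (.var 1) (.assign 5 (.var 7) (.get 3 (.var 7)))) <|
      .seq (.loop 6 (.var 3) pass)
        (.loop 7 (.var 1)
          (.assign 7 (.var 7) (.add (.get 7 (.var 7)) (.get 5 (.var 7))))) with hbody
  have hbodys : body.Static := by
    simp only [hbody, Prog.Static]
    exact ⟨⟨by norm_num, ⟨1, by norm_num, rfl⟩, trivial⟩,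
      ⟨by norm_num, ⟨3, by norm_num, rfl⟩, hps⟩, by norm_num, ⟨1, by norm_num, rfl⟩, trivial⟩
  have hbodya : ∀ a < 4, a ∉ body.arrs := by
    intro a ha
    have := hpa a (by interval_cases a <;> simp)
    simp only [hbody, Prog.arrs, List.mem_append, List.mem_singleton, this, false_or, not_or]
    omega
  have hloopS : (Prog.loop 5 (.var 2) body).Static := ⟨by norm_num, ⟨2, by norm_num, rfl⟩, hbodys⟩
  change toVec d (((Prog.loop 7 (.var 1) (.assign 0 (.var 7) (.sub (.get 0 (.var 7))
    (.div (.get 7 (.var 7)) (.ofInt (.var 2)))))).run O τ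
    ((Prog.loop 5 (.var 2) body).run O τ s₁)).arr 0) = _
  have hin₂ := hin₁.run (O := O) (ω := τ) hloopS
    (fun a ha => by simpa [Prog.arrs] using hbodya a (by omega))
  -- Invariant after `i` chains: `i * S₂` indices are consumed and array `7` is the sum of the chain
  -- ends.
  have hmain := run_loop_frame O τ (v := 5) (n := .var 2) (p := body) (s := s₁)
    (fun i A pos => pos = i * S₂ ∧ toVec d (A 7) =
      ∑ i' ∈ Finset.range i, chain f x (fun j => ω (i' * S₂ + j)) S₂)
    ⟨by simp [hpos], by rw [h7]; ext i; simp [toVec]⟩ (by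
      rintro i - s - hA hV ⟨hp, hsum⟩
      have hV' : ∀ v < 4, s.ivar v = s₁.ivar v := fun v hv => hV v (by
        simp only [List.mem_cons, not_or]
        exact ⟨by omega, hbodys.not_mem_vars hv⟩)
      have hin := hin₁.frame hV' (fun a ha => hA a (hbodya a (by omega)))
      have h3 : toVec d (s.arr 3) = gradient (avg f) x := by
        rw [hA 3 (hbodya 3 (by norm_num))]
        exact hgrad
      rw [hbody, run_seq, run_seq]
      set p₁ : Prog ι := .loop 7 (.var 1) (.assign 5 (.var 7) (.get 3 (.var 7))) with hp₁
      have hp₁s : p₁.Static := ⟨by norm_num, ⟨1, by norm_num, rfl⟩, trivial⟩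
      set t₁ := p₁.run O τ s with ht₁
      have hd : s.ivar 1 = d := hin.1 1 (by norm_num)
      have hin' : InputIntact m S₁ S₂ x data₁ data₂ t₁ :=
        hin.run hp₁s (fun a ha => by simp [hp₁, Prog.arrs]; omega)
      have ht₁3 : toVec d (t₁.arr 3) = gradient (avg f) x := by
        rw [ht₁, run_arr O τ (by simp [hp₁, Prog.arrs]), h3]
      have ht₁5 : toVec d (t₁.arr 5) = gradient (avg f) x := by
        rw [← h3]
        refine toVec_congr fun j hj => run_loop_assign O τ (s.arr 3) (fun i _ s' h1 h2 _ _ => ?_)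
          (by rwa [hd])
        simp only [RExp.eval, IExp.eval, h1]
        rw [h2 3 (by norm_num)]
      have ht₁7 : t₁.arr 7 = s.arr 7 := run_arr O τ (by simp [hp₁, Prog.arrs]) s
      have ht₁p : t₁.pos = i * S₂ := (run_pos O τ (by simp [hp₁, Prog.Deterministic]) s).trans hp
      set p₂ : Prog ι := .loop 6 (.var 3) pass with hp₂
      have hp₂s : p₂.Static := ⟨by norm_num, ⟨3, by norm_num, rfl⟩, hps⟩
      have hp₂a : ∀ a ∈ [0, 1, 2, 3, 7], a ∉ p₂.arrs := hpa
      -- Invariant after `j` passes of chain `i`: array `5` holds the iterate `X_j`.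
      have hinner := run_loop_frame O τ (v := 6) (n := .var 3) (p := pass) (s := t₁)
        (fun j A pos => pos = i * S₂ + j ∧
          toVec d (A 5) = chain f x (fun j => ω (i * S₂ + j)) j)
        ⟨by simp [ht₁p], by rw [ht₁5]; rfl⟩ (by
          rintro j - s' - hA' hV' ⟨hpj, hch⟩
          have hin'' := hin'.frame (s' := s')
            (fun v hv => hV' v (by
              simp only [List.mem_cons, not_or]
              exact ⟨by omega, hps.not_mem_vars hv⟩))
            (fun a ha => hA' a (hpa a (by interval_cases a <;> simp)))
          obtain ⟨h5, h6⟩ := hpass s' hin''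
          refine ⟨by rw [h6, hpj, add_assoc], ?_⟩
          rw [h5, hA' 3 (hpa 3 (by simp)), ht₁3, hch, hpj]
          rfl)
      have hS₂ : t₁.ivar 3 = S₂ := hin'.1 3 (by norm_num)
      simp only [IExp.eval, hS₂] at hinner
      set t₂ := p₂.run O τ t₁ with ht₂
      have ht₂d : t₂.ivar 1 = d :=
        (run_ivar O τ (hp₂s.not_mem_vars (by norm_num)) t₁).trans (hin'.1 1 (by norm_num))
      have ht₂7 : t₂.arr 7 = s.arr 7 := (run_arr O τ (hp₂a 7 (by simp)) t₁).trans ht₁7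
      refine ⟨?_, ?_⟩
      · rw [run_pos O τ (by simp [Prog.Deterministic]), hinner.1]
        ring
      · rw [Finset.sum_range_succ, ← hsum, ← hinner.2]
        ext j
        have hj : (j : ℕ) < t₂.ivar 1 := by simp [ht₂d]
        rw [toVec_apply, run_loop_assign O τ (fun j => s.arr 7 j + t₂.arr 5 j)
          (fun i _ s' h1 h2 _ h4 => ?_) hj]
        · rfl
        · simp only [RExp.eval, IExp.eval, h1]
          rw [h2 5 (by norm_num), h4, ht₂7])
  have hS₁ : s₁.ivar 2 = S₁ := hin₁.1 2 (by norm_num)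
  simp only [IExp.eval, hS₁] at hmain
  set s₂ := (Prog.loop 5 (.var 2) body).run O τ s₁ with hs₂
  have hS₁' : s₂.ivar 2 = S₁ := hin₂.1 2 (by norm_num)
  have hd : s₂.ivar 1 = d := hin₂.1 1 (by norm_num)
  have hx : s₂.arr 0 = ofVec x := hin₂.2 0 (by norm_num)
  rw [step, ← hmain.2]
  ext j
  have hj : (j : ℕ) < s₂.ivar 1 := by simp [hd]
  rw [toVec_apply, run_loop_assign O τ (fun j => ofVec x j - s₂.arr 7 j / S₁)
    (fun i _ s' h1 h2 h3 h4 => ?_) hj]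
  · simp [ofVec, toVec_apply]
    ring
  · simp only [RExp.eval, IExp.eval, h1]
    rw [h2 7 (by norm_num), h3 2 (by norm_num), h4, hS₁', hx]

/-! ### Gradient and Hessian of the average -/

theorem differentiable_gradient {d : ℕ} {g : Vec d → ℝ} (hg : ContDiff ℝ 2 g) :
    Differentiable ℝ (gradient g) := by
  have h1 : Differentiable ℝ (fderiv ℝ g) :=
    (hg.fderiv_right (m := 1) (by norm_num)).differentiable (by norm_num)
  have h2 : gradient g = fun x => (InnerProductSpace.toDual ℝ (Vec d)).symm (fderiv ℝ g x) := rfl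
  rw [h2]
  exact (InnerProductSpace.toDual ℝ (Vec d)).symm.toContinuousLinearEquiv.differentiable.comp h1

theorem gradient_avg {m d : ℕ} {f : Fin m → Vec d → ℝ} (hf : ∀ k, Differentiable ℝ (f k)) :
    gradient (avg f) = fun x => (1 / (m : ℝ)) • ∑ k, gradient (f k) x := by
  funext x
  have h : HasFDerivAt (avg f) ((1 / (m : ℝ)) • ∑ k, fderiv ℝ (f k) x) x :=
    (HasFDerivAt.fun_sum fun k _ => (hf k x).hasFDerivAt).const_mul (1 / (m : ℝ))
  simp only [gradient, h.fderiv]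
  simp

theorem hess_avg {m d : ℕ} {f : Fin m → Vec d → ℝ} (hf : ∀ k, ContDiff ℝ 2 (f k)) (x : Vec d) :
    hess (avg f) x = (1 / (m : ℝ)) • ∑ k, hess (f k) x := by
  rw [hess, gradient_avg fun k => (hf k).differentiable (by norm_num)]
  exact ((HasFDerivAt.fun_sum fun k _ => (differentiable_gradient (hf k) x).hasFDerivAt).const_smul
    (1 / (m : ℝ))).fderiv

/-! ### The program for a general objective -/

/-- Array `3` becomes the mean of the gradients of the components. -/
def gradProg : Prog GeneralOracle :=
  .seq
    (.loop 4 (.var 0) <| .seq (.call .grad (.var 4) 0 4) <|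
      .loop 7 (.var 1) (.assign 3 (.var 7) (.add (.get 3 (.var 7)) (.get 4 (.var 7)))))
    (.loop 7 (.var 1) (.assign 3 (.var 7) (.div (.get 3 (.var 7)) (.ofInt (.var 0)))))

/-- One pass of the inner loop with the full Hessian of a random component. -/
def passProg : Prog GeneralOracle :=
  .seq (.sample 9) <| .seq (.call .hess (.var 9) 0 4) <| .seq
    (.loop 7 (.var 1) <|
      .seq (.assign 6 (.var 7) (.add (.get 3 (.var 7)) (.get 5 (.var 7)))) <|
      .loop 8 (.var 1) (.assign 6 (.var 7) (.sub (.get 6 (.var 7))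
        (.mul (.get 4 (.add (.mul (.var 7) (.var 1)) (.var 8))) (.get 5 (.var 8))))))
    (.loop 7 (.var 1) (.assign 5 (.var 7) (.get 6 (.var 7))))

theorem gradProg_static : gradProg.Static :=
  ⟨⟨by norm_num, ⟨0, by norm_num, rfl⟩, trivial, by norm_num, ⟨1, by norm_num, rfl⟩, trivial⟩,
    by norm_num, ⟨1, by norm_num, rfl⟩, trivial⟩

theorem passProg_static : passProg.Static :=
  ⟨by norm_num [Prog.Static], trivial, ⟨by norm_num, ⟨1, by norm_num, rfl⟩, trivial, by norm_num,
    ⟨1, by norm_num, rfl⟩, trivial⟩, by norm_num, ⟨1, by norm_num, rfl⟩, trivial⟩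

theorem run_gradProg {m d : ℕ} {f : Fin m → Vec d → ℝ} (hf : ∀ k, Differentiable ℝ (f k))
    (S₁ S₂ : ℕ) (x : Vec d) (data₁ data₂ : ℕ → ℝ) (ω : ℕ → ℕ) :
    toVec d ((gradProg.run (generalOracle f) ω (initState m S₁ S₂ x data₁ data₂)).arr 3) =
      gradient (avg f) x := by
  set O := generalOracle f
  set s₀ := initState m S₁ S₂ x data₁ data₂ with hs₀
  set body : Prog GeneralOracle := .seq (.call .grad (.var 4) 0 4) <|
      .loop 7 (.var 1) (.assign 3 (.var 7) (.add (.get 3 (.var 7)) (.get 4 (.var 7)))) with hbody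
  have h0 : s₀.ivar 0 = m := rfl
  have h1 : s₀.ivar 1 = d := rfl
  have hmain := run_loop_frame O ω (v := 4) (n := .var 0) (p := body) (s := s₀)
    (fun n A _ => n ≤ m ∧ ∀ i : Fin d, A 3 i =
      ∑ k ∈ Finset.univ.filter (fun k : Fin m => (k : ℕ) < n), gradient (f k) x i)
    ⟨by simp, by simp [hs₀, initState]⟩ (by
      rintro k hk s' hk' hA hV ⟨-, hsum⟩
      have hkm : k < m := hk
      refine ⟨hkm, fun i => ?_⟩
      have hx : s'.arr 0 = ofVec x := hA 0 (by simp [hbody, Prog.arrs])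
      have hd : s'.ivar 1 = d := hV 1 (by simp [hbody, Prog.vars])
      rw [hbody, run_seq,
        run_loop_assign O ω (fun i => s'.arr 3 i + ofVec (gradient (f ⟨k, hkm⟩) x) i)
        (fun j hj s'' h1 h2 _ h4 => ?_) (by rw [run_ivar O ω (by simp [Prog.vars]), hd]; exact i.2)]
      · have : (Finset.univ.filter fun l : Fin m => (l : ℕ) < k + 1) =
            insert ⟨k, hkm⟩ (Finset.univ.filter fun l : Fin m => (l : ℕ) < k) := by
          ext l
          simp [Fin.ext_iff]
          omega
        rw [this, Finset.sum_insert (by simp), hsum]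
        simp [ofVec]
        ring
      · have hj' : j < d := by
          have : j < s'.ivar 1 := hj
          rwa [hd] at this
        simp only [RExp.eval, IExp.eval, h1]
        rw [h2 4 (by norm_num), h4]
        simp only [Prog.run, IExp.eval, hk']
        simp [O, generalOracle, hj', hkm, hx, toVec_ofVec, Function.update])
  rw [gradProg, run_seq]
  simp only [IExp.eval, h0] at hmain
  set s₁ := (Prog.loop 4 (.var 0) body).run O ω s₀ with hs₁
  have hstat : (Prog.loop 4 (.var 0) body).Static := gradProg_static.1
  have hd : s₁.ivar 1 = d := run_ivar O ω (hstat.not_mem_vars (by norm_num)) s₀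
  have hm : s₁.ivar 0 = m := run_ivar O ω (hstat.not_mem_vars (by norm_num)) s₀
  rw [gradient_avg hf]
  ext i
  rw [toVec_apply, run_loop_assign O ω (fun i => s₁.arr 3 i / m) (fun j hj s'' h1 h2 h3 h4 => ?_)
    (by simp [hd])]
  · rw [hmain.2]
    simp
    ring
  · simp only [RExp.eval, IExp.eval, h1, h4]
    rw [h3 0 (by norm_num), hm]

theorem run_passProg {m d : ℕ} (f : Fin m → Vec d → ℝ)
    {S₁ S₂ : ℕ} {x : Vec d} {data₁ data₂ : ℕ → ℝ} (ω : ℕ → Fin m) {s : State}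
    (hs : InputIntact m S₁ S₂ x data₁ data₂ s) :
    toVec d ((passProg.run (generalOracle f) (fun n => ω n) s).arr 5) = toVec d (s.arr 3) +
        (toVec d (s.arr 5) - hess (f (ω s.pos)) x (toVec d (s.arr 5))) ∧
      (passProg.run (generalOracle f) (fun n => ω n) s).pos = s.pos + 1 := by
  set O := generalOracle f
  set τ : ℕ → ℕ := fun n => ω n
  have hx : s.arr 0 = ofVec x := hs.2 0 (by norm_num)
  have hd : s.ivar 1 = d := hs.1 1 (by norm_num)
  set k := ω s.pos with hk
  rw [passProg, run_seq, run_seq]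
  set s₁ := (Prog.call GeneralOracle.hess (.var 9) 0 4).run O τ ((Prog.sample 9).run O τ s) with hs₁
  have hd₁ : s₁.ivar 1 = d := hd
  have h3 : s₁.arr 3 = s.arr 3 := rfl
  have h5 : s₁.arr 5 = s.arr 5 := rfl
  have h4 : ∀ i j : Fin d, s₁.arr 4 (i * d + j) =
      hess (f k) x (EuclideanSpace.single j 1) i := by
    intro i j
    have hlt : (i * d + j : ℕ) < d * d := by
      have := i.2
      have := j.2
      nlinarith
    have hmod : (i * d + j : ℕ) % d = j := by
      rw [Nat.mul_comm, Nat.mul_add_mod, Nat.mod_eq_of_lt j.2]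
    have hdiv : (i * d + j : ℕ) / d = i := by
      rw [Nat.mul_comm, Nat.mul_add_div (by have := i.2; omega), Nat.div_eq_of_lt j.2, add_zero]
    simp [hs₁, Prog.run, State.tick, State.setVar, O, generalOracle, hlt, hmod, hdiv, IExp.eval, τ,
      hx, toVec_ofVec, ← hk]
    simp [ofVec]
  rw [run_seq]
  refine ⟨?_, ?_⟩
  swap
  · rw [run_pos O τ (by simp [Prog.Deterministic]), run_pos O τ (by simp [Prog.Deterministic])]
    rfl
  set body : Prog GeneralOracle :=
    .seq (.assign 6 (.var 7) (.add (.get 3 (.var 7)) (.get 5 (.var 7)))) <|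
      .loop 8 (.var 1) (.assign 6 (.var 7) (.sub (.get 6 (.var 7))
        (.mul (.get 4 (.add (.mul (.var 7) (.var 1)) (.var 8))) (.get 5 (.var 8))))) with hbody
  set r : ℕ → ℝ := fun i => s.arr 3 i + s.arr 5 i +
    ∑ j ∈ Finset.range d, -(s₁.arr 4 (i * d + j) * s.arr 5 j) with hr
  -- Finished rows are kept in array `6`, because every row of the matrix product still reads the
  -- old array `5`.
  have hmain := run_loop_frame O τ (v := 7) (n := .var 1) (p := body) (s := s₁)
    (fun n A _ => ∀ i < n, A 6 i = r i) (by simp) (by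
      rintro i hi s' hi' hA hV hprev
      rw [hbody, run_seq]
      have hd' : s'.ivar 1 = d := (hV 1 (by simp [hbody, Prog.vars])).trans hd₁
      have h3' : s'.arr 3 = s.arr 3 := hA 3 (by simp [hbody, Prog.arrs])
      have h5' : s'.arr 5 = s.arr 5 := hA 5 (by simp [hbody, Prog.arrs])
      have h4' : s'.arr 4 = s₁.arr 4 := hA 4 (by simp [hbody, Prog.arrs])
      set s'' := (Prog.assign 6 (.var 7) (.add (.get 3 (.var 7)) (.get 5 (.var 7)))).run O τ s'
        with hs''
      have h6'' : s''.arr 6 = Function.update (s'.arr 6) i (s.arr 3 i + s.arr 5 i) := by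
        simp [hs'', Prog.run, State.tick, State.setEntry, IExp.eval, RExp.eval, hi', h3', h5']
      have hd'' : s''.ivar 1 = d := hd'
      have hi'' : s''.ivar 7 = i := hi'
      rw [run_loop_sum O τ (c := i) (fun j => -(s₁.arr 4 (i * d + j) * s.arr 5 j))
        (fun t ht => by simp only [IExp.eval]; rw [ht 7 (by norm_num), hi''])
        (fun j hj t h1 h2 h3 => by
          simp only [RExp.eval, IExp.eval]
          rw [h3 7 (by norm_num), h3 1 (by norm_num), h2 4 (by norm_num), h2 5 (by norm_num), h1,
            hi'', hd'']
          have e1 : s''.arr 4 = s₁.arr 4 := h4'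
          have e2 : s''.arr 5 = s.arr 5 := h5'
          rw [e1, e2]
          ring), h6'', hd'']
      intro l hl
      rcases eq_or_ne l i with rfl | hne
      · simp [hr]
      · rw [Function.update_of_ne hne, Function.update_of_ne hne]
        exact hprev l (by omega))
  simp only [IExp.eval, hd₁] at hmain
  set s₂ := (Prog.loop 7 (.var 1) body).run O τ s₁ with hs₂
  have hd₂ : s₂.ivar 1 = d := (run_ivar O τ (by simp [hbody, Prog.vars]) s₁).trans hd₁
  ext i
  rw [toVec_apply, run_loop_assign O τ r (fun j hj t h1 h2 h3 h4 => ?_) (by simp [hd₂])]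
  · have hsum : hess (f k) x (toVec d (s.arr 5)) i =
        ∑ j : Fin d, s₁.arr 4 (i * d + j) * s.arr 5 j := by
      have hv : toVec d (s.arr 5) = ∑ j : Fin d, s.arr 5 j • EuclideanSpace.single j (1 : ℝ) := by
        ext l
        simp [toVec_apply, Pi.single_apply]
      simp_rw [h4]
      rw [hv]
      simp only [map_sum, map_smul, WithLp.ofLp_sum, Finset.sum_apply, PiLp.smul_apply, smul_eq_mul]
      exact Finset.sum_congr rfl fun j _ => mul_comm _ _
    simp only [hr, PiLp.add_apply, PiLp.sub_apply, hsum, toVec_apply]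
    rw [Finset.sum_range fun j => -(s₁.arr 4 (i * d + j) * s.arr 5 j), Finset.sum_neg_distrib]
    ring
  · simp only [RExp.eval, IExp.eval, h1]
    rw [h2 6 (by norm_num), hmain j (by rwa [← hd₂])]

theorem run_stepProg_general {m d : ℕ} {f : Fin m → Vec d → ℝ} (hf : ∀ k, Differentiable ℝ (f k))
    (S₁ S₂ : ℕ) (x : Vec d) (data₁ data₂ : ℕ → ℝ) (ω : ℕ → Fin m) :
    toVec d (((stepProg gradProg passProg).run (generalOracle f) (fun n => ω n)
      (initState m S₁ S₂ x data₁ data₂)).arr 0) = step f S₁ S₂ x (fun i j => ω (i * S₂ + j)) :=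
  run_stepProg gradProg_static (by simp [gradProg, Prog.Deterministic])
    (by simp [gradProg, Prog.arrs]) passProg_static (by simp [passProg, Prog.arrs])
    (run_gradProg hf S₁ S₂ x data₁ data₂ _) fun _ hs => run_passProg f ω hs

/-! ### Generalized linear models -/

theorem IsGLM.gradient_eq {m d : ℕ} {f : Fin m → Vec d → ℝ} {ℓ : Fin m → ℝ → ℝ} {v : Fin m → Vec d}
    {lam : ℝ} (h : IsGLM f ℓ v lam) (k : Fin m) :
    gradient (f k) = fun x => deriv (ℓ k) (inner ℝ (v k) x) • v k + lam • x := by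
  funext x
  have hfk : f k = fun x => ℓ k (inner ℝ (v k) x) + lam / 2 * ‖x‖ ^ 2 := funext (h.2 k)
  have h1 : HasDerivAt (ℓ k) (deriv (ℓ k) (inner ℝ (v k) x)) (inner ℝ (v k) x) :=
    ((h.1 k).differentiable (by norm_num) _).hasDerivAt
  have h2 : HasFDerivAt (fun x : Vec d => inner ℝ (v k) x) (innerSL ℝ (v k)) x :=
    (innerSL ℝ (v k)).hasFDerivAt
  have h3 := (h1.comp_hasFDerivAt x h2).add
    ((hasStrictFDerivAt_norm_sq x).hasFDerivAt.const_mul (lam / 2))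
  rw [hfk]
  refine HasGradientAt.gradient ?_
  rw [hasGradientAt_iff_hasFDerivAt]
  refine h3.congr_fderiv ?_
  ext y
  simp
  ring

/-- A rank-one matrix plus a multiple of the identity: this is what lets a pass take order `d`
operations, namely two inner products and one combination of vectors. -/
theorem IsGLM.hess_apply {m d : ℕ} {f : Fin m → Vec d → ℝ} {ℓ : Fin m → ℝ → ℝ} {v : Fin m → Vec d}
    {lam : ℝ} (h : IsGLM f ℓ v lam) (k : Fin m) (x y : Vec d) :
    hess (f k) x y =
      (deriv (deriv (ℓ k)) (inner ℝ (v k) x) * inner ℝ (v k) y) • v k + lam • y := by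
  have h1 : HasDerivAt (deriv (ℓ k)) (deriv (deriv (ℓ k)) (inner ℝ (v k) x))
      (inner ℝ (v k) x) := by
    have : ContDiff ℝ 1 (deriv (ℓ k)) := (contDiff_succ_iff_deriv.1 (h.1 k)).2.2
    exact (this.differentiable (by norm_num) _).hasDerivAt
  have h2 : HasFDerivAt (fun x : Vec d => inner ℝ (v k) x) (innerSL ℝ (v k)) x :=
    (innerSL ℝ (v k)).hasFDerivAt
  have h3 := (h1.comp_hasFDerivAt x h2).smul_const (v k)
  have h4 : HasFDerivAt (fun y : Vec d => lam • y) (lam • ContinuousLinearMap.id ℝ (Vec d)) x :=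
    (hasFDerivAt_id x).const_smul lam
  rw [hess, h.gradient_eq k]
  refine (congrArg (fun A : Vec d →L[ℝ] Vec d => A y) (h3.add h4).fderiv).trans ?_
  simp

/-- Entry `0` of array `8` becomes the inner product of the data vector with number `u` (an integer
variable) and array `b`. -/
def innerProg (u b : ℕ) : Prog GLMOracle :=
  .seq (.assign 8 (.const 0) (.ofInt (.const 0)))
    (.loop 7 (.var 1) (.assign 8 (.const 0) (.add (.get 8 (.const 0))
      (.mul (.get 1 (.add (.mul (.var u) (.var 1)) (.var 7))) (.get b (.var 7))))))

/-- Array `3` becomes the gradient of the average. -/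
def gradProgGLM : Prog GLMOracle :=
  .seq
    (.loop 4 (.var 0) <| .seq (innerProg 4 0) <| .seq (.call .deriv (.var 4) 8 4) <|
      .loop 7 (.var 1) (.assign 3 (.var 7) (.add (.get 3 (.var 7))
        (.mul (.get 4 (.const 0)) (.get 1 (.add (.mul (.var 4) (.var 1)) (.var 7)))))))
    (.loop 7 (.var 1) (.assign 3 (.var 7) (.add (.div (.get 3 (.var 7)) (.ofInt (.var 0)))
      (.mul (.get 2 (.const 0)) (.get 0 (.var 7))))))

/-- One pass of the inner loop, with the rank-one structure of the Hessian. -/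
def passProgGLM : Prog GLMOracle :=
  .seq (.sample 9) <| .seq (innerProg 9 0) <| .seq (.call .deriv2 (.var 9) 8 4) <|
    .seq (innerProg 9 5) <|
    .loop 7 (.var 1) (.assign 5 (.var 7) (.add (.get 3 (.var 7)) (.sub (.get 5 (.var 7))
      (.add (.mul (.mul (.get 4 (.const 0)) (.get 8 (.const 0)))
          (.get 1 (.add (.mul (.var 9) (.var 1)) (.var 7))))
        (.mul (.get 2 (.const 0)) (.get 5 (.var 7)))))))

theorem innerProg_static (u b : ℕ) : (innerProg u b).Static :=
  ⟨trivial, by norm_num, ⟨1, by norm_num, rfl⟩, trivial⟩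

theorem gradProgGLM_static : gradProgGLM.Static :=
  ⟨⟨by norm_num, ⟨0, by norm_num, rfl⟩, innerProg_static _ _, trivial, by norm_num,
    ⟨1, by norm_num, rfl⟩, trivial⟩, by norm_num, ⟨1, by norm_num, rfl⟩, trivial⟩

theorem passProgGLM_static : passProgGLM.Static :=
  ⟨by norm_num [Prog.Static], innerProg_static _ _, trivial, innerProg_static _ _, by norm_num,
    ⟨1, by norm_num, rfl⟩, trivial⟩

theorem glmData_apply {m d : ℕ} (v : Fin m → Vec d) (k : Fin m) (i : Fin d) :
    glmData v (k * d + i) = v k i := by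
  have hmod : (k * d + i : ℕ) % d = i := by
    rw [Nat.mul_comm, Nat.mul_add_mod, Nat.mod_eq_of_lt i.2]
  have hdiv : (k * d + i : ℕ) / d = k := by
    rw [Nat.mul_comm, Nat.mul_add_div (by have := i.2; omega), Nat.div_eq_of_lt i.2, add_zero]
  simp [glmData, hmod, hdiv, ofVec]

theorem run_innerProg {m d : ℕ} (O : Oracle GLMOracle) (ω : ℕ → ℕ) (v : Fin m → Vec d)
    {u b : ℕ} (hb : b ≠ 8) (hu : u ≠ 7) {s : State} (k : Fin m) (hk : s.ivar u = k)
    (hd : s.ivar 1 = d) (h1 : s.arr 1 = glmData v) :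
    ((innerProg u b).run O ω s).arr 8 0 = inner ℝ (v k) (toVec d (s.arr b)) := by
  rw [innerProg, run_seq]
  set s₁ := (Prog.assign 8 (.const 0) (.ofInt (.const 0))).run O ω s with hs₁
  have h8 : s₁.arr 8 0 = 0 := by
    simp [hs₁, Prog.run, State.tick, State.setEntry, IExp.eval, RExp.eval]
  have hb₁ : s₁.arr b = s.arr b := run_arr O ω (by simpa [Prog.arrs] using hb) s
  have h1₁ : s₁.arr 1 = glmData v := (run_arr O ω (by simp [Prog.arrs]) s).trans h1
  have hd₁ : s₁.ivar 1 = d := hd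
  have hk₁ : s₁.ivar u = k := hk
  rw [run_loop_sum O ω (c := 0) (fun j => glmData v (k * d + j) * s.arr b j) (fun _ _ => rfl)
    (fun j _ t e1 e2 e3 => by
      simp only [RExp.eval, IExp.eval]
      rw [e2 1 (by norm_num), e2 b hb, e3 u hu, e3 1 (by norm_num), e1, hb₁, h1₁, hd₁, hk₁]),
    Function.update_self, h8, hd₁, zero_add,
    Finset.sum_range fun j => glmData v (k * d + j) * s.arr b j]
  simp only [glmData_apply, PiLp.inner_apply, toVec_apply]
  exact Finset.sum_congr rfl fun j _ => by simp [mul_comm]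

theorem run_gradProgGLM {m d : ℕ} (hm : 1 ≤ m) {f : Fin m → Vec d → ℝ}
    (hf : ∀ k, Differentiable ℝ (f k)) {ℓ : Fin m → ℝ → ℝ} {v : Fin m → Vec d} {lam : ℝ}
    (hglm : IsGLM f ℓ v lam) (S₁ S₂ : ℕ) (x : Vec d) (ω : ℕ → ℕ) :
    toVec d ((gradProgGLM.run (glmOracle ℓ) ω
      (initState m S₁ S₂ x (glmData v) (fun n => if n = 0 then lam else 0))).arr 3) =
      gradient (avg f) x := by
  set O := glmOracle ℓ
  set s₀ := initState m S₁ S₂ x (glmData v) (fun n => if n = 0 then lam else 0) with hs₀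
  set body : Prog GLMOracle := .seq (innerProg 4 0) <| .seq (.call .deriv (.var 4) 8 4) <|
      .loop 7 (.var 1) (.assign 3 (.var 7) (.add (.get 3 (.var 7))
        (.mul (.get 4 (.const 0)) (.get 1 (.add (.mul (.var 4) (.var 1)) (.var 7)))))) with hbody
  have h0 : s₀.ivar 0 = m := rfl
  have hmain := run_loop_frame O ω (v := 4) (n := .var 0) (p := body) (s := s₀)
    (fun n A _ => n ≤ m ∧ ∀ i : Fin d, A 3 i =
      ∑ k ∈ Finset.univ.filter (fun k : Fin m => (k : ℕ) < n),
        deriv (ℓ k) (inner ℝ (v k) x) * v k i)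
    ⟨by simp, by simp [hs₀, initState]⟩ (by
      rintro k hk s' hk' hA hV ⟨-, hsum⟩
      have hkm : k < m := hk
      refine ⟨hkm, fun i => ?_⟩
      have hx : s'.arr 0 = ofVec x := hA 0 (by simp [hbody, innerProg, Prog.arrs])
      have h1 : s'.arr 1 = glmData v := hA 1 (by simp [hbody, innerProg, Prog.arrs])
      have hd : s'.ivar 1 = d := hV 1 (by simp [hbody, innerProg, Prog.vars])
      rw [hbody, run_seq, run_seq]
      have h8 := run_innerProg O ω v (u := 4) (b := 0) (by norm_num) (by norm_num)
        ⟨k, hkm⟩ hk' hd h1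
      rw [hx, toVec_ofVec] at h8
      set s₁ := (innerProg 4 0).run O ω s' with hs₁
      have hk₁ : s₁.ivar 4 = k :=
        (run_ivar O ω (by simp [innerProg, Prog.vars]) s').trans hk'
      have hd₁ : s₁.ivar 1 = d :=
        (run_ivar O ω (by simp [innerProg, Prog.vars]) s').trans hd
      have h1₁ : s₁.arr 1 = glmData v :=
        (run_arr O ω (by simp [innerProg, Prog.arrs]) s').trans h1
      have h3₁ : s₁.arr 3 = s'.arr 3 := run_arr O ω (by simp [innerProg, Prog.arrs]) s'
      set s₂ := (Prog.call GLMOracle.deriv (.var 4) 8 4).run O ω s₁ with hs₂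
      have hk₂ : s₂.ivar 4 = k := hk₁
      have hd₂ : s₂.ivar 1 = d := hd₁
      have h1₂ : s₂.arr 1 = glmData v := (run_arr O ω (by simp [Prog.arrs]) s₁).trans h1₁
      have h3₂ : s₂.arr 3 = s'.arr 3 := (run_arr O ω (by simp [Prog.arrs]) s₁).trans h3₁
      have h4₂ : s₂.arr 4 0 = deriv (ℓ ⟨k, hkm⟩) (inner ℝ (v ⟨k, hkm⟩) x) := by
        simp [hs₂, Prog.run, O, glmOracle, IExp.eval, hk₁, hkm, h8]
      rw [run_loop_assign O ω (fun i => s'.arr 3 i +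
          deriv (ℓ ⟨k, hkm⟩) (inner ℝ (v ⟨k, hkm⟩) x) * glmData v (k * d + i))
        (fun j hj t e1 e2 e3 e4 => ?_) (by rw [hd₂]; exact i.2)]
      · have : (Finset.univ.filter fun l : Fin m => (l : ℕ) < k + 1) =
            insert ⟨k, hkm⟩ (Finset.univ.filter fun l : Fin m => (l : ℕ) < k) := by
          ext l
          simp [Fin.ext_iff]
          omega
        rw [this, Finset.sum_insert (by simp), hsum]
        have := glmData_apply v ⟨k, hkm⟩ i
        simp only at this
        rw [this]
        ring
      · simp only [RExp.eval, IExp.eval, e1]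
        rw [e2 4 (by norm_num), e2 1 (by norm_num), e3 4 (by norm_num), e3 1 (by norm_num), e4,
          hk₂, hd₂, h1₂, h3₂, h4₂])
  rw [gradProgGLM, run_seq]
  simp only [IExp.eval, h0] at hmain
  set s₁ := (Prog.loop 4 (.var 0) body).run O ω s₀ with hs₁
  have hstat : (Prog.loop 4 (.var 0) body).Static := gradProgGLM_static.1
  have hd : s₁.ivar 1 = d := run_ivar O ω (hstat.not_mem_vars (by norm_num)) s₀
  have hm₁ : s₁.ivar 0 = m := run_ivar O ω (hstat.not_mem_vars (by norm_num)) s₀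
  have hx₁ : s₁.arr 0 = ofVec x := run_arr O ω (by simp [hbody, innerProg, Prog.arrs]) s₀
  have hl₁ : s₁.arr 2 0 = lam := by
    rw [hs₁, run_arr O ω (by simp [hbody, innerProg, Prog.arrs]) s₀]
    simp [hs₀, initState]
  rw [gradient_avg hf]
  ext i
  rw [toVec_apply, run_loop_assign O ω (fun i => s₁.arr 3 i / m + lam * ofVec x i)
    (fun j hj t e1 e2 e3 e4 => ?_) (by simp [hd])]
  -- The program adds the regularizer once, after averaging; `m ≠ 0` is needed for the mean of `m`
  -- copies of `lam • x` to be `lam • x`.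
  · have hm0 : (m : ℝ) ≠ 0 := by positivity
    rw [hmain.2]
    simp [hglm.gradient_eq, Finset.sum_add_distrib, ofVec]
    field_simp
  · simp only [RExp.eval, IExp.eval, e1, e4]
    rw [e3 0 (by norm_num), e2 2 (by norm_num), e2 0 (by norm_num), hm₁, hl₁, hx₁]

theorem run_passProgGLM {m d : ℕ} {f : Fin m → Vec d → ℝ} {ℓ : Fin m → ℝ → ℝ} {v : Fin m → Vec d}
    {lam : ℝ} (hglm : IsGLM f ℓ v lam) {S₁ S₂ : ℕ} {x : Vec d} (ω : ℕ → Fin m) {s : State}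
    (hs : InputIntact m S₁ S₂ x (glmData v) (fun n => if n = 0 then lam else 0) s) :
    toVec d ((passProgGLM.run (glmOracle ℓ) (fun n => ω n) s).arr 5) = toVec d (s.arr 3) +
        (toVec d (s.arr 5) - hess (f (ω s.pos)) x (toVec d (s.arr 5))) ∧
      (passProgGLM.run (glmOracle ℓ) (fun n => ω n) s).pos = s.pos + 1 := by
  set O := glmOracle ℓ
  set τ : ℕ → ℕ := fun n => ω n
  set k := ω s.pos with hk
  refine ⟨?_, ?_⟩
  swap
  · rw [passProgGLM, run_seq, run_pos O τ (by simp [innerProg, Prog.Deterministic])]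
    rfl
  rw [passProgGLM, run_seq, run_seq, run_seq, run_seq]
  set s₁ := (Prog.sample 9).run O τ s with hs₁
  have hk₁ : s₁.ivar 9 = k := by simp [hs₁, Prog.run, State.setVar, State.tick, τ, hk]
  have hd₁ : s₁.ivar 1 = d := hs.1 1 (by norm_num)
  have hx₁ : s₁.arr 0 = ofVec x := hs.2 0 (by norm_num)
  have h1₁ : s₁.arr 1 = glmData v := hs.2 1 (by norm_num)
  have h8₂ := run_innerProg O τ v (u := 9) (b := 0) (by norm_num) (by norm_num) k hk₁ hd₁ h1₁
  rw [hx₁, toVec_ofVec] at h8₂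
  set s₂ := (innerProg 9 0).run O τ s₁ with hs₂
  have hk₂ : s₂.ivar 9 = k := (run_ivar O τ (by simp [innerProg, Prog.vars]) s₁).trans hk₁
  have hd₂ : s₂.ivar 1 = d := (run_ivar O τ (by simp [innerProg, Prog.vars]) s₁).trans hd₁
  have ha₂ : ∀ a ≠ 8, s₂.arr a = s.arr a := fun a ha =>
    run_arr O τ (by simpa [innerProg, Prog.arrs] using ha) s₁
  set s₃ := (Prog.call GLMOracle.deriv2 (.var 9) 8 4).run O τ s₂ with hs₃
  have hk₃ : s₃.ivar 9 = k := hk₂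
  have hd₃ : s₃.ivar 1 = d := hd₂
  have ha₃ : ∀ a ≠ 8, a ≠ 4 → s₃.arr a = s.arr a := fun a ha ha' =>
    (run_arr O τ (by simpa [Prog.arrs] using ha') s₂).trans (ha₂ a ha)
  have h1₃ : s₃.arr 1 = glmData v := (ha₃ 1 (by norm_num) (by norm_num)).trans h1₁
  have h4₃ : s₃.arr 4 0 = deriv (deriv (ℓ k)) (inner ℝ (v k) x) := by
    simp [hs₃, Prog.run, O, glmOracle, IExp.eval, hk₂, h8₂]
  -- Entry `0` of array `8` is reused: it was the argument of the oracle and is now `⟨vₖ, X⟩`. With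
  -- this number stored, array `5` can be updated in place, entry by entry.
  have h8₄ := run_innerProg O τ v (u := 9) (b := 5) (by norm_num) (by norm_num) k hk₃ hd₃ h1₃
  rw [ha₃ 5 (by norm_num) (by norm_num)] at h8₄
  set s₄ := (innerProg 9 5).run O τ s₃ with hs₄
  have hk₄ : s₄.ivar 9 = k := (run_ivar O τ (by simp [innerProg, Prog.vars]) s₃).trans hk₃
  have hd₄ : s₄.ivar 1 = d := (run_ivar O τ (by simp [innerProg, Prog.vars]) s₃).trans hd₃
  have ha₄ : ∀ a ≠ 8, s₄.arr a = s₃.arr a := fun a ha =>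
    run_arr O τ (by simpa [innerProg, Prog.arrs] using ha) s₃
  have hl₄ : s₄.arr 2 0 = lam := by
    rw [ha₄ 2 (by norm_num), ha₃ 2 (by norm_num) (by norm_num), hs.2 2 (by norm_num)]
    simp [initState]
  ext i
  rw [toVec_apply, run_loop_assign O τ (fun i => s.arr 3 i + (s.arr 5 i -
      (deriv (deriv (ℓ k)) (inner ℝ (v k) x) * inner ℝ (v k) (toVec d (s.arr 5)) *
        glmData v (k * d + i) + lam * s.arr 5 i)))
    (fun j hj t e1 e2 e3 e4 => ?_) (by simp [hd₄])]
  · rw [glmData_apply]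
    simp [hglm.hess_apply, toVec_apply]
  · simp only [RExp.eval, IExp.eval, e1, e4]
    rw [e3 9 (by norm_num), e3 1 (by norm_num), e2 1 (by norm_num), e2 2 (by norm_num),
      e2 3 (by norm_num), e2 4 (by norm_num), e2 8 (by norm_num), hk₄, hd₄, hl₄, h8₄,
      ha₄ 1 (by norm_num), ha₄ 3 (by norm_num), ha₄ 4 (by norm_num), ha₄ 5 (by norm_num),
      h1₃, h4₃, ha₃ 3 (by norm_num) (by norm_num), ha₃ 5 (by norm_num) (by norm_num)]

theorem run_stepProg_glm {m d : ℕ} (hm : 1 ≤ m) {f : Fin m → Vec d → ℝ}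
    (hf : ∀ k, Differentiable ℝ (f k)) {ℓ : Fin m → ℝ → ℝ} {v : Fin m → Vec d} {lam : ℝ}
    (hglm : IsGLM f ℓ v lam) (S₁ S₂ : ℕ) (x : Vec d) (ω : ℕ → Fin m) :
    toVec d (((stepProg gradProgGLM passProgGLM).run (glmOracle ℓ) (fun n => ω n)
      (initState m S₁ S₂ x (glmData v) (fun n => if n = 0 then lam else 0))).arr 0) =
      step f S₁ S₂ x (fun i j => ω (i * S₂ + j)) :=
  run_stepProg gradProgGLM_static (by simp [gradProgGLM, innerProg, Prog.Deterministic])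
    (by simp [gradProgGLM, innerProg, Prog.arrs]) passProgGLM_static
    (by simp [passProgGLM, innerProg, Prog.arrs])
    (run_gradProgGLM hm hf hglm S₁ S₂ x _) fun _ hs => run_passProgGLM hglm ω hs

/-! ### Running times -/

theorem stepProg_static {ι : Type} {grad pass : Prog ι} (hg : grad.Static) (hp : pass.Static) :
    (stepProg grad pass).Static :=
  ⟨hg, ⟨by norm_num, ⟨2, by norm_num, rfl⟩, ⟨by norm_num, ⟨1, by norm_num, rfl⟩, trivial⟩,
    ⟨by norm_num, ⟨3, by norm_num, rfl⟩, hp⟩, by norm_num, ⟨1, by norm_num, rfl⟩, trivial⟩,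
    by norm_num, ⟨1, by norm_num, rfl⟩, trivial⟩

theorem time_general {m d S₁ S₂ : ℕ} (f : Fin m → Vec d → ℝ) (x : Vec d) (ω : ℕ → ℕ) (hm : 1 ≤ m)
    (hd : 1 ≤ d) (h₁ : 1 ≤ S₁) (h₂ : 1 ≤ S₂) :
    ((stepProg gradProg passProg).run (generalOracle f) ω (initState m S₁ S₂ x 0 0)).time ≤
      200 * (m * d + S₁ * S₂ * d ^ 2) := by
  rw [run_time _ _ (stepProg_static gradProg_static passProg_static) (fun _ _ => rfl)]
  simp [stepProg, gradProg, passProg, Prog.timeOf, IExp.cost, RExp.cost, IExp.eval, initState,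
    generalOracle]
  -- Every monomial of the exact running time is at most `m * d` or `S₁ * S₂ * d ^ 2`; the constant
  -- `200` leaves room for the coefficients.
  have h3 : m ≤ m * d := Nat.le_mul_of_pos_right _ hd
  have h4 : d ≤ d ^ 2 := Nat.le_self_pow (by norm_num) d
  have h5 : S₁ ≤ S₁ * S₂ := Nat.le_mul_of_pos_right _ h₂
  have h6 : S₁ * S₂ ≤ S₁ * S₂ * d := Nat.le_mul_of_pos_right _ hd
  have h7 : S₁ * S₂ * d ≤ S₁ * S₂ * d ^ 2 := Nat.mul_le_mul_left _ h4
  have h8 : S₁ * d ≤ S₁ * S₂ * d := Nat.mul_le_mul_right _ h5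
  have h9 : d ≤ S₁ * d := Nat.le_mul_of_pos_left _ h₁
  ring_nf at *
  omega

theorem time_glm {m d S₁ S₂ : ℕ} (ℓ : Fin m → ℝ → ℝ) (x : Vec d) (data₁ data₂ : ℕ → ℝ)
    (ω : ℕ → ℕ) (hm : 1 ≤ m) (hd : 1 ≤ d) (h₁ : 1 ≤ S₁) (h₂ : 1 ≤ S₂) :
    ((stepProg gradProgGLM passProgGLM).run (glmOracle ℓ) ω
      (initState m S₁ S₂ x data₁ data₂)).time ≤ 200 * (m * d + S₁ * S₂ * d) := by
  rw [run_time _ _ (stepProg_static gradProgGLM_static passProgGLM_static) (fun _ _ => rfl)]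
  simp [stepProg, gradProgGLM, passProgGLM, innerProg, Prog.timeOf, IExp.cost, RExp.cost,
    IExp.eval, initState, glmOracle]
  have h3 : m ≤ m * d := Nat.le_mul_of_pos_right _ hd
  have h5 : S₁ ≤ S₁ * S₂ := Nat.le_mul_of_pos_right _ h₂
  have h6 : S₁ * S₂ ≤ S₁ * S₂ * d := Nat.le_mul_of_pos_right _ hd
  have h8 : S₁ * d ≤ S₁ * S₂ * d := Nat.mul_le_mul_right _ h5
  have h9 : d ≤ S₁ * d := Nat.le_mul_of_pos_left _ h₁
  ring_nf at *
  omega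

/-! ### Finite means -/

section Mean

variable {α β E F : Type*} [Fintype α] [Fintype β] [AddCommGroup E] [Module ℝ E]
  [AddCommGroup F] [Module ℝ F]

/-- The mean of a function on a finite type. -/
noncomputable def mean (u : α → E) : E := (Fintype.card α : ℝ)⁻¹ • ∑ a, u a

theorem mean_const [Nonempty α] (c : E) : mean (fun _ : α => c) = c := by
  have : (Fintype.card α : ℝ) ≠ 0 := by exact_mod_cast Fintype.card_ne_zero
  rw [mean, Finset.sum_const, Finset.card_univ, ← Nat.cast_smul_eq_nsmul ℝ, smul_smul,
    inv_mul_cancel₀ this, one_smul]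

theorem mean_add (u w : α → E) : mean (fun a => u a + w a) = mean u + mean w := by
  simp [mean, Finset.sum_add_distrib]

theorem mean_sub (u w : α → E) : mean (fun a => u a - w a) = mean u - mean w := by
  simp [mean, Finset.sum_sub_distrib, smul_sub]

theorem map_mean (A : E →ₗ[ℝ] F) (u : α → E) : A (mean u) = mean fun a => A (u a) := by
  simp [mean]

theorem mean_const_mul (c : ℝ) (u : α → ℝ) : mean (fun a => c * u a) = c * mean u := by
  simp [mean, ← Finset.mul_sum]
  ring

theorem mean_mono {u w : α → ℝ} (h : ∀ a, u a ≤ w a) : mean u ≤ mean w :=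
  mul_le_mul_of_nonneg_left (Finset.sum_le_sum fun a _ => h a) (by positivity)

theorem mean_nonneg {u : α → ℝ} (h : ∀ a, 0 ≤ u a) : 0 ≤ mean u :=
  mul_nonneg (by positivity) (Finset.sum_nonneg fun a _ => h a)

theorem mean_comm (u : α → β → E) :
    (mean fun a => mean fun b => u a b) = mean fun b => mean fun a => u a b := by
  simp only [mean, ← Finset.smul_sum, smul_smul]
  rw [Finset.sum_comm, mul_comm]

/-- Fubini for the last coordinate; it plays the role of conditioning on the past. -/
theorem mean_snoc {n : ℕ} (u : (Fin (n + 1) → α) → E) :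
    mean u = mean fun h : Fin n → α => mean fun a => u (Fin.snoc h a) := by
  have h1 : ∑ b, u b = ∑ h : Fin n → α, ∑ a, u (Fin.snoc h a) := by
    rw [← (Fin.snocEquiv fun _ => α).sum_comp, Fintype.sum_prod_type, Finset.sum_comm]
    rfl
  simp only [mean, ← Finset.smul_sum, smul_smul, h1]
  congr 1
  simp [pow_succ, mul_comm]

theorem norm_mean_le {E : Type*} [SeminormedAddCommGroup E] [NormedSpace ℝ E] (u : α → E) :
    ‖mean u‖ ≤ mean fun a => ‖u a‖ := by
  rw [mean, norm_smul, norm_inv, Real.norm_natCast]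
  exact mul_le_mul_of_nonneg_left (norm_sum_le _ _) (by positivity)

theorem convexOn_cosh : ConvexOn ℝ Set.univ Real.cosh := by
  have h1 := convexOn_exp
  have h2 : ConvexOn ℝ Set.univ fun x : ℝ => Real.exp (-x) :=
    h1.comp_linearMap (-LinearMap.id)
  have h3 := (h1.add h2).smul (c := (1 / 2 : ℝ)) (by norm_num)
  refine h3.congr fun x _ => ?_
  simp [Real.cosh_eq]
  ring

theorem cosh_mean_le [Nonempty α] (u : α → ℝ) :
    Real.cosh (mean u) ≤ mean fun a => Real.cosh (u a) := by
  have hc : (Fintype.card α : ℝ) ≠ 0 := by exact_mod_cast Fintype.card_ne_zero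
  have := convexOn_cosh.map_sum_le (t := Finset.univ) (w := fun _ : α => (Fintype.card α : ℝ)⁻¹)
    (p := u) (fun _ _ => by positivity) (by simp [hc]) (fun _ _ => Set.mem_univ _)
  simpa only [mean, Finset.smul_sum] using this

end Mean

/-! ### Sums of independent bounded vectors -/

/-- Both `x` and `y` lie in `[Y, X]`, with complementary barycentric coordinates, so convexity of `t
^ n` gives two inequalities whose sum is the claim. -/
theorem pow_add_pow_le {x y X Y : ℝ} (hY : 0 ≤ Y) (hYx : Y ≤ x) (hYy : Y ≤ y) (h : x + y = X + Y)
    (n : ℕ) : x ^ n + y ^ n ≤ X ^ n + Y ^ n := by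
  rcases eq_or_lt_of_le (show Y ≤ X by linarith) with hXY | hXY
  · have h1 : x = Y := by linarith
    have h2 : y = Y := by linarith
    rw [h1, h2, hXY]
  · have hpos : 0 < X - Y := by linarith
    have hs : 0 ≤ (x - Y) / (X - Y) := div_nonneg (by linarith) hpos.le
    have ht : 0 ≤ (y - Y) / (X - Y) := div_nonneg (by linarith) hpos.le
    have hst : (x - Y) / (X - Y) + (y - Y) / (X - Y) = 1 := by
      field_simp
      linarith
    have hX : X ∈ Set.Ici (0 : ℝ) := Set.mem_Ici.2 (by linarith)
    have h1 := (convexOn_pow n).2 hX (Set.mem_Ici.2 hY) hs ht hst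
    have h2 := (convexOn_pow n).2 hX (Set.mem_Ici.2 hY) ht hs (by linarith)
    simp only [smul_eq_mul] at h1 h2
    have e1 : (x - Y) / (X - Y) * X + (y - Y) / (X - Y) * Y = x := by
      field_simp
      have : y = X + Y - x := by linarith
      rw [this]
      ring
    have e2 : (y - Y) / (X - Y) * X + (x - Y) / (X - Y) * Y = y := by
      field_simp
      have : x = X + Y - y := by linarith
      rw [this]
      ring
    rw [e1] at h1
    rw [e2] at h2
    calc x ^ n + y ^ n ≤ ((x - Y) / (X - Y) + (y - Y) / (X - Y)) * (X ^ n + Y ^ n) := by linarith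
      _ = X ^ n + Y ^ n := by rw [hst, one_mul]

section Concentration

variable {E : Type*} [NormedAddCommGroup E] [InnerProductSpace ℝ E]

/-- The right side is `cosh (‖v‖ + ‖w‖) + cosh (‖v‖ - ‖w‖)`, and `cosh` is a power series with
nonnegative coefficients in the square of its argument. By the parallelogram law the squares on the
two sides have equal sums, and by Cauchy–Schwarz those on the right are further apart;
`pow_add_pow_le` then applies to each term. -/
theorem cosh_norm_add_add_cosh_norm_sub_le (v w : E) :
    Real.cosh ‖v + w‖ + Real.cosh ‖v - w‖ ≤ 2 * (Real.cosh ‖v‖ * Real.cosh ‖w‖) := by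
  have h1 : 2 * (Real.cosh ‖v‖ * Real.cosh ‖w‖) =
      Real.cosh (‖v‖ + ‖w‖) + Real.cosh (‖v‖ - ‖w‖) := by
    rw [Real.cosh_add, Real.cosh_sub]
    ring
  rw [h1]
  refine hasSum_le (fun n => ?_) ((Real.hasSum_cosh ‖v + w‖).add (Real.hasSum_cosh ‖v - w‖))
    ((Real.hasSum_cosh (‖v‖ + ‖w‖)).add (Real.hasSum_cosh (‖v‖ - ‖w‖)))
  rw [← add_div, ← add_div]
  refine div_le_div_of_nonneg_right ?_ (by positivity)
  simp only [pow_mul]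
  have hle := abs_le.1 (abs_real_inner_le_norm v w)
  refine pow_add_pow_le (sq_nonneg _) ?_ ?_ ?_ n
  · rw [norm_add_sq_real]
    nlinarith [hle.1]
  · rw [norm_sub_sq_real]
    nlinarith [hle.2]
  · rw [norm_add_sq_real, norm_sub_sq_real]
    ring

variable {α : Type*} [Fintype α] [Nonempty α]

/-- Adding one centred bounded vector, by symmetrization. -/
theorem mean_cosh_norm_add_le {Z : α → E} {c : ℝ} (h0 : mean Z = 0) (hZ : ∀ a b, ‖Z a - Z b‖ ≤ c)
    (v : E) : (mean fun a => Real.cosh ‖v + Z a‖) ≤ Real.cosh c * Real.cosh ‖v‖ := by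
  have hc : 0 ≤ c := (norm_nonneg _).trans (hZ (Classical.arbitrary α) (Classical.arbitrary α))
  -- Jensen's inequality with an independent copy `Z b` of mean zero.
  have h1 : ∀ a, Real.cosh ‖v + Z a‖ ≤ mean fun b => Real.cosh ‖v + (Z a - Z b)‖ := by
    intro a
    have e : v + Z a = mean fun b => v + (Z a - Z b) := by
      rw [mean_add (fun _ => v), mean_sub (fun _ => Z a), mean_const, mean_const, h0, sub_zero]
    calc Real.cosh ‖v + Z a‖ ≤ Real.cosh (mean fun b => ‖v + (Z a - Z b)‖) := by
          rw [Real.cosh_le_cosh, abs_of_nonneg (norm_nonneg _),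
            abs_of_nonneg (mean_nonneg fun _ => norm_nonneg _)]
          conv_lhs => rw [e]
          exact norm_mean_le _
      _ ≤ _ := cosh_mean_le _
  -- Exchanging the two copies changes the sign of the difference, so the two signs can be averaged.
  have h2 : (mean fun a => mean fun b => Real.cosh ‖v + (Z a - Z b)‖) =
      mean fun a => mean fun b => Real.cosh ‖v - (Z a - Z b)‖ := by
    rw [mean_comm]
    simp only [sub_eq_add_neg v, neg_sub]
  have h3 : (mean fun a => mean fun b =>
      (Real.cosh ‖v + (Z a - Z b)‖ + Real.cosh ‖v - (Z a - Z b)‖)) ≤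
        2 * (Real.cosh c * Real.cosh ‖v‖) := by
    calc _ ≤ mean fun _ : α => mean fun _ : α => 2 * (Real.cosh c * Real.cosh ‖v‖) := by
          refine mean_mono fun a => mean_mono fun b => ?_
          have h4 : Real.cosh ‖Z a - Z b‖ ≤ Real.cosh c := by
            rw [Real.cosh_le_cosh, abs_of_nonneg (norm_nonneg _), abs_of_nonneg hc]
            exact hZ a b
          have h5 := cosh_norm_add_add_cosh_norm_sub_le v (Z a - Z b)
          have h6 := mul_le_mul_of_nonneg_left h4 (Real.cosh_pos ‖v‖).le
          linarith
      _ = _ := by rw [mean_const, mean_const]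
  simp only [mean_add] at h3
  linarith [mean_mono h1]

theorem mean_cosh_norm_add_sum_le {Z : α → E} {c : ℝ} (h0 : mean Z = 0)
    (hZ : ∀ a b, ‖Z a - Z b‖ ≤ c) (n : ℕ) (v : E) :
    (mean fun b : Fin n → α => Real.cosh ‖v + ∑ i, Z (b i)‖) ≤ Real.cosh c ^ n * Real.cosh ‖v‖ := by
  induction n with
  | zero => simp [mean_const]
  | succ n ih =>
    rw [mean_snoc]
    calc _ ≤ mean fun b : Fin n → α => Real.cosh c * Real.cosh ‖v + ∑ i, Z (b i)‖ := by
          refine mean_mono fun b => ?_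
          simpa [Fin.sum_univ_castSucc, add_assoc] using
            mean_cosh_norm_add_le h0 hZ (v + ∑ i, Z (b i))
      _ ≤ _ := by
          rw [mean_const_mul, pow_succ, mul_comm _ (Real.cosh c), mul_assoc]
          exact mul_le_mul_of_nonneg_left ih (Real.cosh_pos c).le

/-- The exponential moment of the norm of a sum of independent centred bounded vectors. -/
theorem mean_exp_norm_sum_le {Z : α → E} {c : ℝ} (h0 : mean Z = 0)
    (hZ : ∀ a b, ‖Z a - Z b‖ ≤ c) (n : ℕ) :
    (mean fun b : Fin n → α => Real.exp ‖∑ i, Z (b i)‖) ≤ 2 * Real.exp (n * (c ^ 2 / 2)) := by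
  calc _ ≤ mean fun b : Fin n → α => 2 * Real.cosh ‖0 + ∑ i, Z (b i)‖ := by
        refine mean_mono fun b => ?_
        rw [zero_add, Real.cosh_eq]
        linarith [Real.exp_pos (-‖∑ i, Z (b i)‖)]
    _ ≤ 2 * (Real.cosh c ^ n * Real.cosh ‖(0 : E)‖) := by
        rw [mean_const_mul]
        exact mul_le_mul_of_nonneg_left (mean_cosh_norm_add_sum_le h0 hZ n 0) (by norm_num)
    _ ≤ _ := by
        rw [norm_zero, Real.cosh_zero, mul_one, Real.exp_nat_mul]
        gcongr
        exact Real.cosh_le_exp_half_sq c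

end Concentration

/-! ### Symmetric operators -/

/-- Needed for the real `sInf` in `lamMin` to be a true infimum. -/
theorem bddBelow_eigenvalues {d : ℕ} (A : Vec d →L[ℝ] Vec d) :
    BddBelow {μ : ℝ | Module.End.HasEigenvalue (A : Vec d →ₗ[ℝ] Vec d) μ} := by
  refine ⟨-‖A‖, fun μ hμ => ?_⟩
  obtain ⟨w, hw⟩ := Module.End.HasEigenvalue.exists_hasEigenvector hμ
  have h1 : A w = μ • w := hw.apply_eq_smul
  have h2 : |μ| * ‖w‖ ≤ ‖A‖ * ‖w‖ := by
    rw [← Real.norm_eq_abs, ← norm_smul, ← h1]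
    exact A.le_opNorm w
  have h3 := le_of_mul_le_mul_right h2 (norm_pos_iff.2 hw.2)
  linarith [neg_abs_le μ]

theorem lamMin_mul_le {d : ℕ} {A : Vec d →L[ℝ] Vec d} (hA : (A : Vec d →ₗ[ℝ] Vec d).IsSymmetric)
    (v : Vec d) : lamMin A * ‖v‖ ^ 2 ≤ inner ℝ (A v) v := by
  have hn : Module.finrank ℝ (Vec d) = d := by simp
  set b := hA.eigenvectorBasis hn with hb
  have h1 : inner ℝ (A v) v = ∑ i, hA.eigenvalues hn i * (b.repr v i) ^ 2 := by
    rw [← b.repr.inner_map_map, PiLp.inner_apply]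
    refine Finset.sum_congr rfl fun i _ => ?_
    have := hA.eigenvectorBasis_apply_self_apply hn v i
    simp only [ContinuousLinearMap.coe_coe] at this
    rw [hb, this]
    simp
    ring
  have h2 : ‖v‖ ^ 2 = ∑ i, (b.repr v i) ^ 2 := by
    rw [← b.repr.norm_map, EuclideanSpace.norm_sq_eq]
    simp
  rw [h1, h2, Finset.mul_sum]
  refine Finset.sum_le_sum fun i _ => mul_le_mul_of_nonneg_right ?_ (sq_nonneg _)
  exact csInf_le (bddBelow_eigenvalues A) (hA.hasEigenvalue_eigenvalues hn i)

theorem le_lamMin {d : ℕ} (hd : 1 ≤ d) {A : Vec d →L[ℝ] Vec d}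
    (hA : (A : Vec d →ₗ[ℝ] Vec d).IsSymmetric) {c : ℝ}
    (h : ∀ v, c * ‖v‖ ^ 2 ≤ inner ℝ (A v) v) : c ≤ lamMin A := by
  have hn : Module.finrank ℝ (Vec d) = d := by simp
  refine le_csInf ⟨_, hA.hasEigenvalue_eigenvalues hn ⟨0, hd⟩⟩ fun μ hμ => ?_
  obtain ⟨w, hw⟩ := Module.End.HasEigenvalue.exists_hasEigenvector hμ
  have h1 : A w = μ • w := hw.apply_eq_smul
  have h2 := h w
  rw [h1, inner_smul_left, real_inner_self_eq_norm_sq] at h2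
  exact le_of_mul_le_mul_right h2 (by have := norm_pos_iff.2 hw.2; positivity)

/-- Cauchy–Schwarz for the semidefinite form of `B`, applied to `v` and `w = B v`: `‖w‖⁴ ≤ ⟨B w, w⟩
⟨B v, v⟩ ≤ q² ‖w‖² ‖v‖²`. It is obtained from the discriminant of `t ↦ ⟨B (v + t w), v + t w⟩`. -/
theorem norm_le_of_inner_le {d : ℕ} {B : Vec d →L[ℝ] Vec d}
    (hB : (B : Vec d →ₗ[ℝ] Vec d).IsSymmetric) (h0 : ∀ v, 0 ≤ inner ℝ (B v) v) {q : ℝ}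
    (h1 : ∀ v, inner ℝ (B v) v ≤ q * ‖v‖ ^ 2) (v : Vec d) : ‖B v‖ ≤ q * ‖v‖ := by
  rcases eq_or_ne (B v) 0 with hz | hz
  · rcases eq_or_ne v 0 with rfl | hv
    · simp
    · have hq : 0 ≤ q * ‖v‖ ^ 2 := (h0 v).trans (h1 v)
      have hv' := norm_pos_iff.2 hv
      have : 0 ≤ q := nonneg_of_mul_nonneg_left hq (by positivity)
      rw [hz, norm_zero]
      positivity
  · have hw := norm_pos_iff.2 hz
    set w := B v with hwdef
    have hsym : inner ℝ (B w) v = ‖w‖ ^ 2 := by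
      rw [← real_inner_self_eq_norm_sq]
      exact hB w v
    have hquad : ∀ t : ℝ, 0 ≤ inner ℝ (B w) w * (t * t) + 2 * ‖w‖ ^ 2 * t + inner ℝ (B v) v := by
      intro t
      have := h0 (v + t • w)
      simp only [map_add, map_smul, inner_add_left, inner_add_right, inner_smul_left,
        inner_smul_right, hsym, ← hwdef, real_inner_self_eq_norm_sq] at this
      simp only [← hwdef, conj_trivial] at this ⊢
      linarith
    have hdis := discrim_le_zero hquad
    have hv0 : v ≠ 0 := by
      rintro rfl
      simp [hwdef] at hz
    have hv := norm_pos_iff.2 hv0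
    have hq : 0 ≤ q := nonneg_of_mul_nonneg_left ((h0 v).trans (h1 v)) (by positivity)
    rw [discrim] at hdis
    have h2 : inner ℝ (B w) w * inner ℝ (B v) v ≤ (q * ‖w‖ ^ 2) * (q * ‖v‖ ^ 2) :=
      mul_le_mul (h1 w) (h1 v) (h0 v) (by positivity)
    have h3 : (‖w‖ ^ 2) ^ 2 ≤ (q * ‖v‖) ^ 2 * ‖w‖ ^ 2 := by nlinarith
    have h4 : ‖w‖ ^ 2 ≤ (q * ‖v‖) ^ 2 := by
      rw [sq (‖w‖ ^ 2)] at h3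
      exact le_of_mul_le_mul_right h3 (by positivity)
    exact (pow_le_pow_iff_left₀ hw.le (by positivity) (by norm_num)).1 h4

/-- The Loewner order contains the symmetry of `1 - A`; thus symmetry of the Hessians is read off
the curvature bound. -/
theorem isSymmetric_of_le_one {d : ℕ} {A : Vec d →L[ℝ] Vec d} (h : A ≤ 1) :
    (A : Vec d →ₗ[ℝ] Vec d).IsSymmetric := by
  have h1 := ((ContinuousLinearMap.le_def _ _).1 h).isSymmetric
  have h2 : (A : Vec d →ₗ[ℝ] Vec d) =
      LinearMap.id - ((1 - A : Vec d →L[ℝ] Vec d) : Vec d →ₗ[ℝ] Vec d) := by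
    ext v
    simp
  rw [h2]
  exact LinearMap.IsSymmetric.id.sub h1

theorem inner_le_of_le_one {d : ℕ} {A : Vec d →L[ℝ] Vec d} (h : A ≤ 1) (v : Vec d) :
    inner ℝ (A v) v ≤ ‖v‖ ^ 2 := by
  have h1 := ((ContinuousLinearMap.le_def _ _).1 h).inner_nonneg_left v
  simp only [sub_apply, one_apply_eq_self, inner_sub_left,
    real_inner_self_eq_norm_sq] at h1
  linarith

theorem norm_sub_apply_le {d : ℕ} {A : Vec d →L[ℝ] Vec d} (h : A ≤ 1) {c : ℝ}
    (hc : ∀ v, c * ‖v‖ ^ 2 ≤ inner ℝ (A v) v) (v : Vec d) : ‖v - A v‖ ≤ (1 - c) * ‖v‖ := by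
  have hpos := (ContinuousLinearMap.le_def _ _).1 h
  refine norm_le_of_inner_le (B := 1 - A) hpos.isSymmetric
    (fun w => hpos.inner_nonneg_left w) (fun w => ?_) v
  simp only [sub_apply, one_apply_eq_self, inner_sub_left,
    real_inner_self_eq_norm_sq]
  linarith [hc w]

/-! ### Condition numbers -/

section Curvature

variable {m d : ℕ} {f : Fin m → Vec d → ℝ}

theorem hess_avg_apply (hf : ∀ k, ContDiff ℝ 2 (f k)) (x v : Vec d) :
    hess (avg f) x v = mean fun k => hess (f k) x v := by
  simp [hess_avg hf, mean]

theorem hess_avg_le_one (hm : 1 ≤ m) (hf : ∀ k, ContDiff ℝ 2 (f k))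
    (h1 : ∀ k x, hess (f k) x ≤ 1) (x : Vec d) : hess (avg f) x ≤ 1 := by
  have hm0 : (m : ℝ) ≠ 0 := by positivity
  have e : 1 - hess (avg f) x = (1 / (m : ℝ)) • ∑ k, (1 - hess (f k) x) := by
    rw [hess_avg hf, Finset.sum_sub_distrib, smul_sub]
    congr 1
    simp only [Finset.sum_const, Finset.card_univ, Fintype.card_fin]
    rw [← Nat.cast_smul_eq_nsmul ℝ, smul_smul, one_div, inv_mul_cancel₀ hm0, one_smul]
  rw [ContinuousLinearMap.le_def, e, ContinuousLinearMap.isPositive_iff]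
  have hpos := fun k => (ContinuousLinearMap.le_def _ _).1 (h1 k x)
  constructor
  · intro v w
    simp only [ContinuousLinearMap.coe_coe, smul_apply,
      sum_apply, inner_smul_left, inner_smul_right, sum_inner, inner_sum]
    congr 1
    exact Finset.sum_congr rfl fun k _ => (hpos k).isSymmetric v w
  · intro v
    simp only [smul_apply, sum_apply, inner_smul_left,
      sum_inner]
    exact mul_nonneg (by simp) (Finset.sum_nonneg fun k _ => (hpos k).inner_nonneg_left v)

theorem one_div_kappaLocalMax_mul_le (h1 : ∀ k x, hess (f k) x ≤ 1)
    (hpos : ∀ x, 0 < alphaMin f x) (hbdd : BddAbove (Set.range fun x => 1 / alphaMin f x))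
    (k : Fin m) (x v : Vec d) :
    1 / kappaLocalMax f * ‖v‖ ^ 2 ≤ inner ℝ (hess (f k) x v) v := by
  have h2 : 1 / alphaMin f x ≤ kappaLocalMax f := le_ciSup hbdd x
  have h3 : 1 / kappaLocalMax f ≤ alphaMin f x := by
    have := one_div_le_one_div_of_le (one_div_pos.2 (hpos x)) h2
    simpa using this
  have h4 : alphaMin f x ≤ lamMin (hess (f k) x) := ciInf_le (Set.finite_range _).bddBelow k
  exact (mul_le_mul_of_nonneg_right (h3.trans h4) (sq_nonneg _)).trans
    (lamMin_mul_le (isSymmetric_of_le_one (h1 k x)) v)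

/-- The quadratic form of the average is the mean of the component forms, each at least `alphaMin f
x * ‖v‖ ^ 2`. -/
theorem alphaMin_le_lamMin_avg (hm : 1 ≤ m) (hd : 1 ≤ d) (hf : ∀ k, ContDiff ℝ 2 (f k))
    (h1 : ∀ k x, hess (f k) x ≤ 1) (x : Vec d) : alphaMin f x ≤ lamMin (hess (avg f) x) := by
  have : Nonempty (Fin m) := ⟨⟨0, hm⟩⟩
  refine le_lamMin hd (isSymmetric_of_le_one (hess_avg_le_one hm hf h1 x)) fun v => ?_
  rw [hess_avg_apply hf]
  have e : inner ℝ (mean fun k => hess (f k) x v) v = mean fun k => inner ℝ (hess (f k) x v) v := by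
    simp only [real_inner_comm v]
    exact map_mean (innerₛₗ ℝ v) _
  rw [e, ← mean_const (α := Fin m) (alphaMin f x * ‖v‖ ^ 2)]
  refine mean_mono fun k => ?_
  have h4 : alphaMin f x ≤ lamMin (hess (f k) x) := ciInf_le (Set.finite_range _).bddBelow k
  exact (mul_le_mul_of_nonneg_right h4 (sq_nonneg _)).trans
    (lamMin_mul_le (isSymmetric_of_le_one (h1 k x)) v)

theorem lamMin_le_one (hd : 1 ≤ d) {A : Vec d →L[ℝ] Vec d} (h : A ≤ 1) : lamMin A ≤ 1 := by
  have h1 := (lamMin_mul_le (isSymmetric_of_le_one h) (EuclideanSpace.single ⟨0, hd⟩ 1)).trans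
    (inner_le_of_le_one h _)
  simpa using h1

theorem kappaLocal_spec (hm : 1 ≤ m) (hd : 1 ≤ d) (hf : ∀ k, ContDiff ℝ 2 (f k))
    (h1 : ∀ k x, hess (f k) x ≤ 1)
    (hpos : ∀ x, 0 < alphaMin f x) (hbdd : BddAbove (Set.range fun x => 1 / alphaMin f x)) :
    1 ≤ kappaLocal f ∧ kappaLocal f ≤ kappaLocalMax f ∧
      ∀ x v, 1 / kappaLocal f * ‖v‖ ^ 2 ≤ inner ℝ (hess (avg f) x v) v := by
  have hle := alphaMin_le_lamMin_avg hm hd hf h1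
  have hlp : ∀ x, 0 < lamMin (hess (avg f) x) := fun x => (hpos x).trans_le (hle x)
  have hmax : ∀ x, 1 / lamMin (hess (avg f) x) ≤ kappaLocalMax f := fun x =>
    (one_div_le_one_div_of_le (hpos x) (hle x)).trans (le_ciSup hbdd x)
  -- Finiteness of `κ̂_l^max` makes the supremum in `kappaLocal` a true one.
  have hb : BddAbove (Set.range fun x => 1 / lamMin (hess (avg f) x)) :=
    ⟨kappaLocalMax f, by rintro _ ⟨x, rfl⟩; exact hmax x⟩
  refine ⟨?_, ciSup_le hmax, fun x v => ?_⟩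
  · refine le_trans ?_ (le_ciSup hb 0)
    rw [le_div_iff₀ (hlp 0), one_mul]
    exact lamMin_le_one hd (hess_avg_le_one hm hf h1 0)
  · have h2 : 1 / lamMin (hess (avg f) x) ≤ kappaLocal f := le_ciSup hb x
    have h3 : 1 / kappaLocal f ≤ lamMin (hess (avg f) x) := by
      have := one_div_le_one_div_of_le (one_div_pos.2 (hlp x)) h2
      simpa using this
    exact (mul_le_mul_of_nonneg_right h3 (sq_nonneg _)).trans
      (lamMin_mul_le (isSymmetric_of_le_one (hess_avg_le_one hm hf h1 x)) v)

end Curvature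

/-! ### The gradient near the minimizer -/

section Gradient

variable {m d : ℕ} {f : Fin m → Vec d → ℝ}

theorem hasFDerivAt_gradient_avg (hf : ∀ k, ContDiff ℝ 2 (f k)) (x : Vec d) :
    HasFDerivAt (gradient (avg f)) (hess (avg f) x) x := by
  have : ContDiff ℝ 2 (avg f) := by
    unfold avg
    exact contDiff_const.mul (ContDiff.sum fun k _ => hf k)
  exact (differentiable_gradient this x).hasFDerivAt

theorem gradient_eq_zero_of_isMin {g : Vec d → ℝ} {xs : Vec d} (h : ∀ y, g xs ≤ g y) :
    gradient g xs = 0 := by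
  have h1 : IsLocalMin g xs := Filter.Eventually.of_forall h
  simp [gradient, h1.fderiv_eq_zero]

theorem norm_gradient_avg_le (hf : ∀ k, ContDiff ℝ 2 (f k)) {xs : Vec d}
    (hmin : ∀ y, avg f xs ≤ avg f y) (hH : ∀ x v, ‖hess (avg f) x v‖ ≤ ‖v‖) (x : Vec d) :
    ‖gradient (avg f) x‖ ≤ ‖x - xs‖ := by
  have h := Convex.norm_image_sub_le_of_norm_hasFDerivWithin_le (s := Set.univ) (C := 1)
    (fun y _ => (hasFDerivAt_gradient_avg hf y).hasFDerivWithinAt)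
    (fun y _ => ContinuousLinearMap.opNorm_le_bound _ zero_le_one (by simpa using hH y))
    convex_univ (Set.mem_univ xs) (Set.mem_univ x)
  simpa [gradient_eq_zero_of_isMin hmin] using h

theorem norm_sub_gradient_avg_le (hf : ∀ k, ContDiff ℝ 2 (f k)) {xs : Vec d}
    (hmin : ∀ y, avg f xs ≤ avg f y)
    (hH : ∀ x v, ‖v - hess (avg f) x v‖ ≤ ‖v‖) (x : Vec d) :
    ‖(x - xs) - gradient (avg f) x‖ ≤ ‖x - xs‖ := by
  have h := Convex.norm_image_sub_le_of_norm_hasFDerivWithin_le (s := Set.univ) (C := 1)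
    (f := fun y => y - gradient (avg f) y)
    (f' := fun y => ContinuousLinearMap.id ℝ (Vec d) - hess (avg f) y)
    (fun y _ => ((hasFDerivAt_id y).sub (hasFDerivAt_gradient_avg hf y)).hasFDerivWithinAt)
    (fun y _ => ContinuousLinearMap.opNorm_le_bound _ zero_le_one (by simpa using hH y))
    convex_univ (Set.mem_univ xs) (Set.mem_univ x)
  rw [gradient_eq_zero_of_isMin hmin, sub_zero, one_mul] at h
  rwa [show x - xs - gradient (avg f) x = x - gradient (avg f) x - xs by abel]

/-- Mean value inequality on the segment from `xs` to `x` for `∇f` minus the fixed linear map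
`∇²f(x)`, using `∇f(xs) = 0`. This says that `x - xs` nearly solves the Newton equation. -/
theorem norm_hess_sub_gradient_avg_le (hf : ∀ k, ContDiff ℝ 2 (f k)) {xs : Vec d} {M : ℝ}
    (hM0 : 0 ≤ M) (hmin : ∀ y, avg f xs ≤ avg f y)
    (hM : ∀ x y, ‖hess (avg f) x - hess (avg f) y‖ ≤ M * ‖x - y‖) (x : Vec d) :
    ‖hess (avg f) x (x - xs) - gradient (avg f) x‖ ≤ M * ‖x - xs‖ * ‖x - xs‖ := by
  have h := Convex.norm_image_sub_le_of_norm_hasFDerivWithin_le' (s := segment ℝ xs x)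
    (f := gradient (avg f)) (φ := hess (avg f) x) (C := M * ‖x - xs‖)
    (fun y _ => (hasFDerivAt_gradient_avg hf y).hasFDerivWithinAt)
    (fun y hy => (hM y x).trans (mul_le_mul_of_nonneg_left (by
      rw [segment_symm] at hy
      have := norm_sub_le_of_mem_segment hy
      rwa [norm_sub_rev x xs]) hM0))
    (convex_segment _ _) (left_mem_segment ℝ xs x) (right_mem_segment ℝ xs x)
  rw [gradient_eq_zero_of_isMin hmin, sub_zero, norm_sub_rev] at h
  exact h

end Gradient

/-! ### One chain -/

section Chain

variable {m d : ℕ} (f : Fin m → Vec d → ℝ) (x : Vec d)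

/-- The end of a chain, as a function of the finitely many indices that it uses. -/
noncomputable def chainFin : (n : ℕ) → (Fin n → Fin m) → Vec d
  | 0, _ => gradient (avg f) x
  | n + 1, b => gradient (avg f) x + (chainFin n (Fin.init b) -
      hess (f (b (Fin.last n))) x (chainFin n (Fin.init b)))

theorem chain_eq_chainFin (k : ℕ → Fin m) (n : ℕ) :
    chain f x k n = chainFin f x n fun i => k i := by
  induction n with
  | zero => rfl
  | succ n ih =>
    rw [chain, chainFin, ih]
    rfl

variable {f x}

/-- The bound is the fixed point of `s ↦ ‖∇f(x)‖ + (1 - 1/κ) s`. It holds for every draw, so all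
components must contract; hence `κ` will be `kappaLocalMax f` here, while the bias only involves
`kappaLocal f`. -/
theorem norm_chainFin_le {κ : ℝ} (hκ : 1 ≤ κ)
    (hc : ∀ k v, ‖v - hess (f k) x v‖ ≤ (1 - 1 / κ) * ‖v‖) (n : ℕ) (b : Fin n → Fin m) :
    ‖chainFin f x n b‖ ≤ κ * ‖gradient (avg f) x‖ := by
  have hκ0 : 0 < κ := by linarith
  induction n with
  | zero => exact le_mul_of_one_le_left (norm_nonneg _) hκ
  | succ n ih =>
    rw [chainFin]
    refine (norm_add_le _ _).trans ?_
    have h1 := hc (b (Fin.last n)) (chainFin f x n (Fin.init b))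
    have h2 : 0 ≤ 1 - 1 / κ := by
      rw [sub_nonneg, div_le_one hκ0]
      exact hκ
    have h3 := mul_le_mul_of_nonneg_left (ih (Fin.init b)) h2
    have h4 : (1 - 1 / κ) * (κ * ‖gradient (avg f) x‖) =
        κ * ‖gradient (avg f) x‖ - ‖gradient (avg f) x‖ := by
      field_simp
    linarith

/-- The last index is independent of the earlier ones and the recursion is linear, so averaging over
it turns the component Hessian into the full one. -/
theorem mean_chainFin_succ (hm : 1 ≤ m) (hf : ∀ k, ContDiff ℝ 2 (f k)) (n : ℕ) :
    mean (chainFin f x (n + 1)) = gradient (avg f) x + (mean (chainFin f x n) -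
      hess (avg f) x (mean (chainFin f x n))) := by
  have : Nonempty (Fin m) := ⟨⟨0, hm⟩⟩
  rw [mean_snoc]
  simp only [chainFin, Fin.init_snoc, Fin.snoc_last]
  have h1 : ∀ h : Fin n → Fin m, (mean fun a => gradient (avg f) x +
      (chainFin f x n h - hess (f a) x (chainFin f x n h))) =
      gradient (avg f) x + (chainFin f x n h - hess (avg f) x (chainFin f x n h)) := by
    intro h
    rw [mean_add (fun _ => gradient (avg f) x), mean_const, mean_sub (fun _ => chainFin f x n h),
      mean_const, hess_avg_apply hf]
  simp only [h1]
  rw [mean_add (fun _ => gradient (avg f) x), mean_const, mean_sub]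
  have h2 := map_mean (hess (avg f) x : Vec d →ₗ[ℝ] Vec d) (chainFin f x n)
  simp only [ContinuousLinearMap.coe_coe] at h2
  rw [h2]

/-- The expected output of a chain is an approximate Newton direction. -/
theorem norm_sub_mean_chainFin_le (hm : 1 ≤ m) (hf : ∀ k, ContDiff ℝ 2 (f k)) {κ η : ℝ} {e : Vec d}
    (hκ : 1 ≤ κ) (hc : ∀ v, ‖v - hess (avg f) x v‖ ≤ (1 - 1 / κ) * ‖v‖)
    (hη : ‖hess (avg f) x e - gradient (avg f) x‖ ≤ η) (n : ℕ) :
    ‖e - mean (chainFin f x n)‖ ≤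
      (1 - 1 / κ) ^ n * ‖e - gradient (avg f) x‖ + κ * η := by
  have : Nonempty (Fin m) := ⟨⟨0, hm⟩⟩
  have hκ0 : 0 < κ := by linarith
  have hη0 : 0 ≤ η := (norm_nonneg _).trans hη
  induction n with
  | zero =>
    have : mean (chainFin f x 0) = gradient (avg f) x := mean_const _
    rw [this, pow_zero, one_mul]
    have := mul_nonneg hκ0.le hη0
    linarith
  | succ n ih =>
    have e1 : e - mean (chainFin f x (n + 1)) =
        ((e - mean (chainFin f x n)) - hess (avg f) x (e - mean (chainFin f x n))) +
          (hess (avg f) x e - gradient (avg f) x) := by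
      rw [mean_chainFin_succ hm hf, map_sub]
      abel
    have h2 : 0 ≤ 1 - 1 / κ := by
      rw [sub_nonneg, div_le_one hκ0]
      exact hκ
    have h3 := mul_le_mul_of_nonneg_left ih h2
    -- The term `κ * η` is the fixed point of `s ↦ (1 - 1/κ) s + η`.
    have h4 : (1 - 1 / κ) * ((1 - 1 / κ) ^ n * ‖e - gradient (avg f) x‖ + κ * η) =
        (1 - 1 / κ) ^ (n + 1) * ‖e - gradient (avg f) x‖ + κ * η - η := by
      have h5 : 1 / κ * κ = 1 := one_div_mul_cancel hκ0.ne'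
      rw [pow_succ]
      linear_combination -η * h5
    rw [e1]
    have h5 := norm_add_le ((e - mean (chainFin f x n)) -
      hess (avg f) x (e - mean (chainFin f x n))) (hess (avg f) x e - gradient (avg f) x)
    have h6 := hc (e - mean (chainFin f x n))
    linarith

end Chain

/-! ### One step -/

/-- One step, as a function of the finitely many indices that it uses. -/
noncomputable def stepFin {m d : ℕ} (f : Fin m → Vec d → ℝ) (S₁ S₂ : ℕ) (x : Vec d)
    (b : Fin S₁ → Fin S₂ → Fin m) : Vec d :=
  x - (1 / (S₁ : ℝ)) • ∑ i, chainFin f x S₂ (b i)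

theorem step_eq_stepFin {m d : ℕ} (f : Fin m → Vec d → ℝ) (S₁ S₂ : ℕ) (x : Vec d)
    (k : ℕ → ℕ → Fin m) : step f S₁ S₂ x k = stepFin f S₁ S₂ x fun i j => k i j := by
  simp only [step, stepFin, chain_eq_chainFin, Finset.sum_range]

/-- Only `log (4κ) ≥ log 4` is used: the power is at most `exp (-n/κ) ≤ exp (-2 log 4)`. -/
theorem pow_mul_le_one_div {κ : ℝ} (hκ : 1 ≤ κ) {n : ℕ} (hn : 2 * κ * Real.log (4 * κ) ≤ n) :
    (1 - 1 / κ) ^ n ≤ 1 / 16 := by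
  have hκ0 : 0 < κ := by linarith
  have h0 : 0 ≤ 1 - 1 / κ := by
    rw [sub_nonneg, div_le_one hκ0]
    exact hκ
  have h1 : 1 - 1 / κ ≤ Real.exp (-(1 / κ)) := by
    linarith [Real.add_one_le_exp (-(1 / κ))]
  have h4 : Real.log 4 ≤ Real.log (4 * κ) := Real.log_le_log (by norm_num) (by linarith)
  have h5 : 2 * Real.log 4 ≤ n * (1 / κ) := by
    rw [mul_one_div, le_div_iff₀ hκ0]
    nlinarith
  calc (1 - 1 / κ) ^ n ≤ Real.exp (-(1 / κ)) ^ n := pow_le_pow_left₀ h0 h1 n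
    _ = Real.exp (-(n * (1 / κ))) := by rw [← Real.exp_nat_mul]; ring_nf
    _ ≤ Real.exp (-(2 * Real.log 4)) := Real.exp_le_exp.2 (by linarith)
    _ = 1 / 16 := by
      rw [show -(2 * Real.log 4) = Real.log 4 * (-2 : ℝ) by ring, Real.exp_mul,
        Real.exp_log (by norm_num)]
      norm_num [Real.rpow_neg]

/-- A high moment of the error after one step. -/
theorem mean_pow_norm_stepFin_le {m d : ℕ} {f : Fin m → Vec d → ℝ} {S₁ S₂ p : ℕ} {x xs : Vec d}
    {κ : ℝ} (hm : 1 ≤ m) (hS₁ : 1 ≤ S₁) (hp : 1 ≤ p)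
    (hbound : ∀ b, ‖chainFin f x S₂ b‖ ≤ κ * ‖x - xs‖)
    (hbias : ‖(x - xs) - mean (chainFin f x S₂)‖ ≤ 3 / 8 * ‖x - xs‖) :
    (mean fun b => (2 * ‖stepFin f S₁ S₂ x b - xs‖) ^ p) ≤
      2 * Real.exp (-(p / 4) + 8 * p ^ 2 * κ ^ 2 / S₁) * ‖x - xs‖ ^ p := by
  have : Nonempty (Fin m) := ⟨⟨0, hm⟩⟩
  have hS : (0 : ℝ) < S₁ := by exact_mod_cast hS₁
  set D := ‖x - xs‖ with hD
  rcases eq_or_lt_of_le (norm_nonneg (x - xs)) with h0 | h0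
  -- At the minimizer all chains vanish. This case is separate because the scaling `c` below divides
  -- by `D`.
  · have hD0 : D = 0 := h0.symm
    have hch : ∀ b, chainFin f x S₂ b = 0 := fun b =>
      norm_le_zero_iff.1 (by simpa [hD0] using hbound b)
    have hst : ∀ b, ‖stepFin f S₁ S₂ x b - xs‖ = 0 := by
      intro b
      simp [stepFin, hch, ← hD, hD0]
    simp [hst, hD0, mean_const, show p ≠ 0 by omega]
  · set μ := mean (chainFin f x S₂) with hμ
    -- Scaled so that twice the noise of the step is `D / p` times the norm of the sum of the `Z (b
    -- i)`.
    set c : ℝ := 2 * p / (D * S₁) with hc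
    set Z : (Fin S₂ → Fin m) → Vec d := fun b => c • (chainFin f x S₂ b - μ) with hZ
    have hDpos : 0 < D := h0
    have hc0 : 0 ≤ c := by positivity
    have hZ0 : mean Z = 0 := by
      have := map_mean (c • LinearMap.id : Vec d →ₗ[ℝ] Vec d) fun b => chainFin f x S₂ b - μ
      simp only [LinearMap.smul_apply, LinearMap.id_apply] at this
      rw [hZ, ← this, mean_sub _ fun _ => μ, mean_const, sub_self, smul_zero]
    have hZd : ∀ a b, ‖Z a - Z b‖ ≤ 4 * p * κ / S₁ := by
      intro a b
      rw [hZ]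
      simp only
      rw [← smul_sub, sub_sub_sub_cancel_right, norm_smul, Real.norm_of_nonneg hc0]
      calc c * ‖chainFin f x S₂ a - chainFin f x S₂ b‖ ≤ c * (κ * D + κ * D) :=
            mul_le_mul_of_nonneg_left
              ((norm_sub_le _ _).trans (add_le_add (hbound a) (hbound b))) hc0
        _ = _ := by
            rw [hc]
            field_simp
            ring
    have key : ∀ b : Fin S₁ → Fin S₂ → Fin m, (2 * ‖stepFin f S₁ S₂ x b - xs‖) ^ p ≤
        D ^ p * Real.exp (-(p / 4)) * Real.exp ‖∑ i, Z (b i)‖ := by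
      intro b
      have e1 : stepFin f S₁ S₂ x b - xs = ((x - xs) - μ) - (D / (2 * p)) • ∑ i, Z (b i) := by
        have : (D / (2 * p)) • ∑ i, Z (b i) =
            (1 / (S₁ : ℝ)) • ∑ i, chainFin f x S₂ (b i) - μ := by
          have hcc : D / (2 * p) * c = 1 / S₁ := by
            rw [hc]
            have : (p : ℝ) ≠ 0 := by positivity
            field_simp
          rw [hZ, ← Finset.smul_sum, smul_smul, hcc, Finset.sum_sub_distrib, smul_sub]
          congr 1
          rw [Finset.sum_const, Finset.card_univ, Fintype.card_fin, ← Nat.cast_smul_eq_nsmul ℝ,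
            smul_smul, one_div, inv_mul_cancel₀ hS.ne', one_smul]
        rw [this, stepFin]
        abel
      have h2 : 2 * ‖stepFin f S₁ S₂ x b - xs‖ ≤ D * (3 / 4 + ‖∑ i, Z (b i)‖ / p) := by
        rw [e1]
        have h3 := norm_sub_le ((x - xs) - μ) ((D / (2 * p)) • ∑ i, Z (b i))
        rw [norm_smul, Real.norm_of_nonneg (by positivity)] at h3
        have h4 : D / (2 * p) * ‖∑ i, Z (b i)‖ = D * (‖∑ i, Z (b i)‖ / p) / 2 := by
          have : (p : ℝ) ≠ 0 := by positivity
          field_simp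
        linarith
      -- Twice the bias is `3/4 < 1`; by `1 + u ≤ exp u` this gap becomes the factor `exp (-p/4)` in
      -- the `p`-th power, and the noise becomes an exponential moment.
      have h5 : 3 / 4 + ‖∑ i, Z (b i)‖ / p ≤ Real.exp (-(1 / 4) + ‖∑ i, Z (b i)‖ / p) := by
        linarith [Real.add_one_le_exp (-(1 / 4) + ‖∑ i, Z (b i)‖ / p)]
      calc (2 * ‖stepFin f S₁ S₂ x b - xs‖) ^ p
          ≤ (D * Real.exp (-(1 / 4) + ‖∑ i, Z (b i)‖ / p)) ^ p :=
            pow_le_pow_left₀ (by positivity) (h2.trans (mul_le_mul_of_nonneg_left h5 h0.le)) p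
        _ = _ := by
            rw [mul_pow, ← Real.exp_nat_mul, mul_assoc, ← Real.exp_add]
            congr 2
            have : (p : ℝ) ≠ 0 := by positivity
            field_simp
    refine (mean_mono key).trans ?_
    rw [mean_const_mul]
    refine (mul_le_mul_of_nonneg_left (mean_exp_norm_sum_le hZ0 hZd S₁) (by positivity)).trans
      (le_of_eq ?_)
    rw [Real.exp_add, show (S₁ : ℝ) * ((4 * p * κ / S₁) ^ 2 / 2) = 8 * p ^ 2 * κ ^ 2 / S₁ by
      field_simp; ring]
    ring

/-- The exponent of the moment. -/
noncomputable def momentExponent (L : ℝ) : ℕ := ⌈24 * L⌉₊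

theorem one_le_momentExponent {L : ℝ} (hL : Real.log 2 ≤ L) : 1 ≤ momentExponent L := by
  have : 0 < L := (Real.log_pos (by norm_num)).trans_le hL
  exact Nat.one_le_ceil_iff.2 (by linarith)

/-- The constant `2000` makes the noise term at most `p/8`, leaving `exp (-p/8)` with `p/8 ≥ 3L`.
One `L` pays for `δ`, the other two for the factor `4`, since `L ≥ log 2`. Rounding up is absorbed
by `24 L + 1 ≤ 26 L`. -/
theorem exp_moment_bound {δ L κ S : ℝ} {d : ℕ} (hδ : 0 < δ) (hd : 1 ≤ d) (hδd : 2 * δ ≤ d)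
    (hLdef : L = Real.log (d / δ)) (hκ : 0 < κ) (hS : 2000 * κ ^ 2 * L ≤ S) :
    2 * Real.exp (-(momentExponent L / 4) + 8 * momentExponent L ^ 2 * κ ^ 2 / S) ≤ δ / 2 := by
  have hd1 : (1 : ℝ) ≤ d := by exact_mod_cast hd
  have hL2 : Real.log 2 ≤ L := by
    rw [hLdef]
    refine Real.log_le_log (by norm_num) ?_
    rw [le_div_iff₀ hδ]
    exact hδd
  have hlog2 : 0.69 < Real.log 2 := by linarith [Real.log_two_gt_d9]
  have hL0 : 0 < L := by linarith
  have hp1 : 24 * L ≤ momentExponent L := Nat.le_ceil _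
  have hp2 : (momentExponent L : ℝ) ≤ 26 * L := by
    have : (momentExponent L : ℝ) < 24 * L + 1 := Nat.ceil_lt_add_one (by linarith)
    linarith
  set p : ℝ := (momentExponent L : ℝ)
  have hp0 : 0 < p := by linarith
  have hSpos : 0 < S := lt_of_lt_of_le (by positivity) hS
  have h1 : 8 * p ^ 2 * κ ^ 2 / S ≤ p / 8 := by
    rw [div_le_iff₀ hSpos]
    have : p / 8 * (2000 * κ ^ 2 * L) ≤ p / 8 * S := mul_le_mul_of_nonneg_left hS (by positivity)
    have h2 : 8 * p ^ 2 * κ ^ 2 ≤ 8 * p * (26 * L) * κ ^ 2 := by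
      rw [sq p, ← mul_assoc]
      gcongr
    have h3 : 0 ≤ p * L * κ ^ 2 := by positivity
    linarith
  have h2 : -Real.log δ ≤ L := by
    rw [hLdef, Real.log_div (by positivity) hδ.ne']
    linarith [Real.log_nonneg hd1]
  have h3 : Real.log 4 = 2 * Real.log 2 := by
    rw [show (4 : ℝ) = 2 ^ 2 by norm_num, Real.log_pow]
    norm_num
  calc 2 * Real.exp (-(p / 4) + 8 * p ^ 2 * κ ^ 2 / S)
      ≤ 2 * Real.exp (Real.log δ - Real.log 4) := by
        gcongr
        linarith
    _ = δ / 2 := by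
        rw [Real.exp_sub, Real.exp_log hδ, Real.exp_log (by norm_num)]
        ring

/-! ### Probabilities on finite types -/

section Prob

variable {α : Type*} [Fintype α]

open Classical in
/-- The fraction of the elements of a finite type that satisfy a predicate. -/
noncomputable def prob (Q : α → Prop) : ℝ := mean fun a => if Q a then 1 else 0

theorem prob_eq_mean (Q : α → Prop) [DecidablePred Q] :
    prob Q = mean fun a => if Q a then (1 : ℝ) else 0 := by
  unfold prob
  congr!

theorem prob_true [Nonempty α] : prob (fun _ : α => True) = 1 := by
  simp [prob, mean_const]

theorem prob_false : prob (fun _ : α => False) = 0 := by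
  simp [prob, mean]

theorem prob_snoc {n : ℕ} (Q : (Fin (n + 1) → α) → Prop) :
    prob Q = mean fun h : Fin n → α => prob fun a => Q (Fin.snoc h a) :=
  mean_snoc _

theorem prob_compl [Nonempty α] (Q : α → Prop) : prob (fun a => ¬ Q a) = 1 - prob Q := by
  classical
  rw [prob_eq_mean, prob_eq_mean, eq_sub_iff_add_eq, ← mean_add]
  refine Eq.trans ?_ (mean_const (α := α) (1 : ℝ))
  congr 1
  funext a
  by_cases h : Q a <;> simp [h]

theorem prob_le_mean {Q : α → Prop} {u : α → ℝ} (h0 : ∀ a, 0 ≤ u a) (h1 : ∀ a, Q a → 1 ≤ u a) :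
    prob Q ≤ mean u := by
  classical
  rw [prob_eq_mean]
  refine mean_mono fun a => ?_
  split_ifs with h
  · exact h1 a h
  · exact h0 a

theorem prob_le_one [Nonempty α] (Q : α → Prop) : prob Q ≤ 1 := by
  rw [← mean_const (α := α) (1 : ℝ)]
  exact prob_le_mean (fun _ => zero_le_one) fun _ _ => le_rfl

theorem eq_zero_of_mean_le_zero {u : α → ℝ} (h0 : ∀ a, 0 ≤ u a) (h : mean u ≤ 0) (a : α) :
    u a = 0 := by
  have hc : (0 : ℝ) < Fintype.card α := by
    exact_mod_cast Fintype.card_pos_iff.2 ⟨a⟩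
  have h1 : ∑ b, u b ≤ 0 := nonpos_of_mul_nonpos_right h (inv_pos.2 hc)
  exact (Finset.sum_eq_zero_iff_of_nonneg fun b _ => h0 b).1
    (le_antisymm h1 (Finset.sum_nonneg fun b _ => h0 b)) a (Finset.mem_univ a)

end Prob

/-! ### A random dynamical system that contracts in a high moment -/

section Dynamics

variable {X β : Type*} (F : X → β → X) (x₀ : X)

/-- The state after `n` steps, as a function of the noise in these steps. -/
def traj : (n : ℕ) → (Fin n → β) → X
  | 0, _ => x₀
  | n + 1, h => F (traj n (Fin.init h)) (h (Fin.last n))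

theorem traj_snoc (n : ℕ) (h : Fin n → β) (b : β) :
    traj F x₀ (n + 1) (Fin.snoc h b) = F (traj F x₀ n h) b := by
  simp [traj]

variable (V : X → ℝ) (q : ℝ)

/-- The first `n` steps stay in the region `q V ≤ 1`. -/
def Stays : (n : ℕ) → (Fin n → β) → Prop
  | 0, _ => True
  | n + 1, h => Stays n (Fin.init h) ∧ q * V (traj F x₀ (n + 1) h) ≤ 1

/-- Each of the first `n` steps halves `V`. -/
def Halves : (n : ℕ) → (Fin n → β) → Prop
  | 0, _ => True
  | n + 1, h => Halves n (Fin.init h) ∧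
      V (traj F x₀ (n + 1) h) ≤ V (traj F x₀ n (Fin.init h)) / 2

variable {F x₀ V q}

theorem Stays.le_one (h₀ : q * V x₀ ≤ 1) {n : ℕ} {h : Fin n → β} (hs : Stays F x₀ V q n h) :
    q * V (traj F x₀ n h) ≤ 1 := by
  cases n with
  | zero => exact h₀
  | succ n => exact hs.2

theorem Halves.le (hV : ∀ x, 0 ≤ V x) {n : ℕ} {h : Fin n → β} (hs : Halves F x₀ V n h) :
    V (traj F x₀ n h) ≤ V x₀ := by
  induction n with
  | zero => exact le_rfl
  | succ n ih => linarith [ih hs.1, hs.2, hV (traj F x₀ n (Fin.init h))]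

variable [Fintype β] {p : ℕ} {δ : ℝ}

/-- Markov's inequality for the `p`-th power. If `V x = 0`, the moment bound forces `V` to stay
zero. -/
theorem prob_not_halve_le (hV : ∀ x, 0 ≤ V x) (hp : 1 ≤ p) (hδ : 0 ≤ δ) {x : X}
    (hx : (mean fun b => (2 * V (F x b)) ^ p) ≤ δ / 2 * V x ^ p) :
    prob (fun b => ¬ V (F x b) ≤ V x / 2) ≤ δ / 2 := by
  have hp0 : p ≠ 0 := by omega
  have hnn : ∀ b, 0 ≤ (2 * V (F x b)) ^ p := fun b => pow_nonneg (by linarith [hV (F x b)]) p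
  rcases eq_or_lt_of_le (hV x) with h0 | h0
  · rw [← h0, zero_pow hp0, mul_zero] at hx
    have h1 : ∀ b, V (F x b) = 0 := fun b => by
      have := pow_eq_zero_iff hp0 |>.1 (eq_zero_of_mean_le_zero hnn hx b)
      linarith
    simp only [h1, ← h0, zero_div, le_refl, not_true_eq_false, prob_false]
    linarith
  · have hpow : 0 < V x ^ p := pow_pos h0 p
    calc prob (fun b => ¬ V (F x b) ≤ V x / 2)
        ≤ mean fun b => (V x ^ p)⁻¹ * (2 * V (F x b)) ^ p := by
          refine prob_le_mean (fun b => mul_nonneg (by positivity) (hnn b)) fun b hb => ?_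
          rw [inv_mul_eq_div, one_le_div hpow]
          exact pow_le_pow_left₀ h0.le (by linarith [not_le.1 hb]) p
      _ ≤ δ / 2 := by
          rw [mean_const_mul, inv_mul_eq_div, div_le_iff₀ hpow]
          exact hx

theorem mean_scaled_pow_le (hq : 0 ≤ q) (hV : ∀ x, 0 ≤ V x) (hp : 1 ≤ p) (hδ : 0 ≤ δ) {x : X}
    (hx : (mean fun b => (2 * V (F x b)) ^ p) ≤ δ / 2 * V x ^ p) :
    (mean fun b => (q * V (F x b)) ^ p) ≤ δ / 4 * (q * V x) ^ p := by
  have e : ∀ b, (q * V (F x b)) ^ p = (q / 2) ^ p * (2 * V (F x b)) ^ p := by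
    intro b
    rw [← mul_pow]
    congr 1
    ring
  have h2 : (q / 2) ^ p ≤ q ^ p / 2 := by
    rw [div_pow]
    refine div_le_div_of_nonneg_left (by positivity) (by norm_num) ?_
    calc (2 : ℝ) = 2 ^ 1 := by norm_num
      _ ≤ 2 ^ p := pow_le_pow_right₀ (by norm_num) hp
  simp only [e]
  rw [mean_const_mul]
  have hVp : 0 ≤ δ / 2 * V x ^ p := mul_nonneg (by linarith) (pow_nonneg (hV x) p)
  calc (q / 2) ^ p * mean (fun b => (2 * V (F x b)) ^ p)
      ≤ q ^ p / 2 * (δ / 2 * V x ^ p) :=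
        mul_le_mul h2 hx (mean_nonneg fun b => pow_nonneg (by linarith [hV (F x b)]) p)
          (by positivity)
    _ = δ / 4 * (q * V x) ^ p := by rw [mul_pow]; ring

variable [Nonempty β]

-- The moment of `q V`, restricted to the paths that have not left the region, contracts by `δ/4`
-- per step: the one-step bound is available exactly on these paths, and restricting further only
-- decreases the mean.
open Classical in
theorem mean_stays_pow_le (hq : 0 ≤ q) (hV : ∀ x, 0 ≤ V x) (hp : 1 ≤ p) (hδ : 0 ≤ δ)
    (h₀ : q * V x₀ ≤ 1)
    (hF : ∀ x, q * V x ≤ 1 → (mean fun b => (2 * V (F x b)) ^ p) ≤ δ / 2 * V x ^ p) (n : ℕ) :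
    (mean fun h : Fin n → β => if Stays F x₀ V q n h then
      mean fun b => (q * V (F (traj F x₀ n h) b)) ^ p else 0) ≤ (δ / 4) ^ (n + 1) := by
  have hstep : ∀ n, (mean fun h : Fin n → β => if Stays F x₀ V q n h then
      mean fun b => (q * V (F (traj F x₀ n h) b)) ^ p else 0) ≤
      δ / 4 * mean fun h : Fin n → β => if Stays F x₀ V q n h then
        (q * V (traj F x₀ n h)) ^ p else 0 := by
    intro n
    rw [← mean_const_mul]
    refine mean_mono fun h => ?_
    split_ifs with hs
    · exact mean_scaled_pow_le hq hV hp hδ (hF _ (hs.le_one h₀))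
    · simp
  have hδ4 : 0 ≤ δ / 4 := by linarith
  induction n with
  | zero =>
    refine (hstep 0).trans ?_
    rw [zero_add, pow_one]
    refine mul_le_of_le_one_right hδ4 ?_
    refine (mean_mono (w := fun _ => 1) fun h => ?_).trans_eq (mean_const 1)
    split_ifs
    · exact pow_le_one₀ (mul_nonneg hq (hV x₀)) h₀
    · exact zero_le_one
  | succ n ih =>
    refine (hstep (n + 1)).trans ?_
    rw [pow_succ' _ (n + 1)]
    refine mul_le_mul_of_nonneg_left (le_trans ?_ ih) hδ4
    rw [mean_snoc]
    refine mean_mono fun h => ?_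
    by_cases hs : Stays F x₀ V q n h
    · rw [if_pos hs]
      refine mean_mono fun b => ?_
      rw [traj_snoc]
      split_ifs
      · exact le_rfl
      · exact pow_nonneg (mul_nonneg hq (hV _)) p
    · simp [Stays, hs, mean_const]

/-- By Markov, the region is left for the first time at step `n + 1` with probability at most
`(δ/4)^(n+1)`. The bound dominates the geometric sum and stays below `δ/2` for all `n`. -/
theorem prob_not_stays_le (hq : 0 ≤ q) (hV : ∀ x, 0 ≤ V x) (hp : 1 ≤ p) (hδ : 0 ≤ δ) (hδ1 : δ ≤ 1)
    (h₀ : q * V x₀ ≤ 1)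
    (hF : ∀ x, q * V x ≤ 1 → (mean fun b => (2 * V (F x b)) ^ p) ≤ δ / 2 * V x ^ p) (n : ℕ) :
    prob (fun h : Fin n → β => ¬ Stays F x₀ V q n h) ≤ δ / 2 * (1 - (δ / 4) ^ n) := by
  classical
  induction n with
  | zero => simp [Stays, prob_false]
  | succ n ih =>
    have h1 := mean_stays_pow_le hq hV hp hδ h₀ hF n
    have h2 : prob (fun h : Fin (n + 1) → β => ¬ Stays F x₀ V q (n + 1) h) ≤
        prob (fun h : Fin n → β => ¬ Stays F x₀ V q n h) +
        mean fun h : Fin n → β => if Stays F x₀ V q n h then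
          mean fun b => (q * V (F (traj F x₀ n h) b)) ^ p else 0 := by
      rw [prob_snoc, prob_eq_mean fun h : Fin n → β => ¬ Stays F x₀ V q n h, ← mean_add]
      refine mean_mono fun h => ?_
      by_cases hs : Stays F x₀ V q n h
      · simp only [Stays, Fin.init_snoc, hs, traj_snoc, true_and, if_true, not_true_eq_false,
          if_false, zero_add]
        exact prob_le_mean (fun b => pow_nonneg (mul_nonneg hq (hV _)) p)
          fun b hb => one_le_pow₀ (not_le.1 hb).le
      · simp [Stays, hs, prob_true]
    have h3 : 0 ≤ (δ / 4) ^ n := by positivity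
    rw [pow_succ] at h1 ⊢
    have h4 : (δ / 4) ^ n * δ * (1 - δ) ≥ 0 := by
      have : 0 ≤ 1 - δ := by linarith
      positivity
    nlinarith

/-- Step `n` halves `V` with probability at least `1 - δ`, whatever happened before. -/
theorem one_sub_le_prob_halve (hq : 0 ≤ q) (hV : ∀ x, 0 ≤ V x) (hp : 1 ≤ p) (hδ : 0 ≤ δ)
    (hδ1 : δ ≤ 1) (h₀ : q * V x₀ ≤ 1)
    (hF : ∀ x, q * V x ≤ 1 → (mean fun b => (2 * V (F x b)) ^ p) ≤ δ / 2 * V x ^ p) (n : ℕ) :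
    1 - δ ≤ prob fun h : Fin (n + 1) → β =>
      V (traj F x₀ (n + 1) h) ≤ V (traj F x₀ n (Fin.init h)) / 2 := by
  classical
  have h1 := prob_not_stays_le hq hV hp hδ hδ1 h₀ hF n
  have h2 : prob (fun h : Fin (n + 1) → β =>
      ¬ V (traj F x₀ (n + 1) h) ≤ V (traj F x₀ n (Fin.init h)) / 2) ≤
      prob (fun h : Fin n → β => ¬ Stays F x₀ V q n h) + δ / 2 := by
    rw [prob_snoc, prob_eq_mean fun h : Fin n → β => ¬ Stays F x₀ V q n h,
      ← mean_const (α := Fin n → β) (δ / 2), ← mean_add]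
    refine mean_mono fun h => ?_
    simp only [traj_snoc, Fin.init_snoc]
    -- Inside the region the step fails with probability at most `δ/2`; paths that have left it are
    -- counted as failures.
    by_cases hs : Stays F x₀ V q n h
    · simp only [hs, not_true_eq_false, if_false, zero_add]
      exact prob_not_halve_le hV hp hδ (hF _ (hs.le_one h₀))
    · simp only [hs, not_false_eq_true, if_true]
      linarith [prob_le_one fun b => ¬ V (F (traj F x₀ n h) b) ≤ V (traj F x₀ n h) / 2]
  rw [prob_compl] at h2
  have h3 : 0 ≤ δ / 2 * (δ / 4) ^ n := by positivity
  linarith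

/-- If all earlier steps halved `V`, the path is still in the region, so the next step succeeds with
conditional probability at least `1 - δ/2`. -/
theorem pow_le_prob_halves (hq : 0 ≤ q) (hV : ∀ x, 0 ≤ V x) (hp : 1 ≤ p) (hδ : 0 ≤ δ)
    (hδ1 : δ ≤ 1) (h₀ : q * V x₀ ≤ 1)
    (hF : ∀ x, q * V x ≤ 1 → (mean fun b => (2 * V (F x b)) ^ p) ≤ δ / 2 * V x ^ p) (n : ℕ) :
    (1 - δ) ^ n ≤ prob fun h : Fin n → β => Halves F x₀ V n h := by
  classical
  induction n with
  | zero => simp [Halves, prob_true]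
  | succ n ih =>
    have h1 : (1 - δ) * prob (fun h : Fin n → β => Halves F x₀ V n h) ≤
        prob fun h : Fin (n + 1) → β => Halves F x₀ V (n + 1) h := by
      rw [prob_snoc, prob_eq_mean fun h : Fin n → β => Halves F x₀ V n h, ← mean_const_mul]
      refine mean_mono fun h => ?_
      by_cases hs : Halves F x₀ V n h
      · simp only [Halves, Fin.init_snoc, hs, traj_snoc, true_and, if_true, mul_one]
        have h2 := prob_not_halve_le hV hp hδ
          (hF _ ((mul_le_mul_of_nonneg_left (hs.le hV) hq).trans h₀))
        rw [prob_compl] at h2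
        linarith
      · simp [Halves, hs, prob_false]
    rw [pow_succ']
    exact (mul_le_mul_of_nonneg_left ih (by linarith)).trans h1

end Dynamics

/-! ### The law of the indices -/

/-- By independence and uniformity all values of the finite index array are equally likely, and the
event is the disjoint union of those that satisfy `Q`. -/
theorem measureReal_eq_prob {m : ℕ} {Ω : Type*} [MeasurableSpace Ω] {P : Measure Ω}
    [IsProbabilityMeasure P] {k : ℕ → ℕ → ℕ → Ω → Fin m} (hk : IsUniformSampling P k)
    (T S₁ S₂ : ℕ) (Q : (Fin T → Fin S₁ → Fin S₂ → Fin m) → Prop) :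
    P.real {ω | Q fun t i j => k t i j ω} = prob Q := by
  classical
  obtain ⟨hmeas, hind, hunif⟩ := hk
  have hone : ∀ h : Fin T → Fin S₁ → Fin S₂ → Fin m,
      P.real {ω | (fun (t : Fin T) (i : Fin S₁) (j : Fin S₂) => k t i j ω) = h} =
        (Fintype.card (Fin T → Fin S₁ → Fin S₂ → Fin m) : ℝ)⁻¹ := by
    intro h
    have hg : Function.Injective fun r : Fin T × Fin S₁ × Fin S₂ =>
        ((r.1 : ℕ), (r.2.1 : ℕ), (r.2.2 : ℕ)) := by
      rintro ⟨t, i, j⟩ ⟨t', i', j'⟩ h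
      simpa [Fin.ext_iff] using h
    have h1 := (hind.precomp hg).measure_inter_preimage_eq_mul Finset.univ
      (sets := fun r => {h r.1 r.2.1 r.2.2}) (fun _ _ => measurableSet_singleton _)
    have h2 : {ω | (fun (t : Fin T) (i : Fin S₁) (j : Fin S₂) => k t i j ω) = h} =
        ⋂ r ∈ (Finset.univ : Finset (Fin T × Fin S₁ × Fin S₂)),
          (fun ω => k r.1 r.2.1 r.2.2 ω) ⁻¹' {h r.1 r.2.1 r.2.2} := by
      ext ω
      simp [funext_iff]
    rw [measureReal_def, h2]
    refine (congrArg ENNReal.toReal h1).trans ?_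
    rw [ENNReal.toReal_prod]
    have h3 : ∀ r : Fin T × Fin S₁ × Fin S₂,
        (P ((fun ω => k r.1 r.2.1 r.2.2 ω) ⁻¹' {h r.1 r.2.1 r.2.2})).toReal = 1 / (m : ℝ) :=
      fun r => hunif r.1 r.2.1 r.2.2 (h r.1 r.2.1 r.2.2)
    refine (Finset.prod_congr rfl fun r _ => h3 r).trans ?_
    simp [← pow_mul]
    ring
  have hset : {ω | Q fun t i j => k t i j ω} = ⋃ h ∈ Finset.univ.filter Q,
      {ω | (fun (t : Fin T) (i : Fin S₁) (j : Fin S₂) => k t i j ω) = h} := by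
    ext ω
    simp
  have hms : ∀ h, MeasurableSet
      {ω | (fun (t : Fin T) (i : Fin S₁) (j : Fin S₂) => k t i j ω) = h} := by
    intro h
    have : Measurable fun ω => fun (t : Fin T) (i : Fin S₁) (j : Fin S₂) => k t i j ω :=
      measurable_pi_lambda _ fun t => measurable_pi_lambda _ fun i =>
        measurable_pi_lambda _ fun j => hmeas t i j
    exact this (measurableSet_singleton h)
  rw [hset, measureReal_biUnion_finset (fun h _ h' _ hne => by
    rw [Function.onFun, Set.disjoint_left]
    rintro ω rfl h2
    exact hne h2) fun h _ => hms h]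
  simp only [hone, prob_eq_mean, mean]
  rw [Finset.sum_ite]
  simp
  ring

/-! ### Convergence -/

theorem iter_eq_traj {m d : ℕ} (f : Fin m → Vec d → ℝ) (S₁ S₂ : ℕ) (x₁ : Vec d)
    (k : ℕ → ℕ → ℕ → Fin m) (n : ℕ) :
    iter f S₁ S₂ x₁ k n = traj (stepFin f S₁ S₂) x₁ n fun t i j => k t i j := by
  induction n with
  | zero => rfl
  | succ n ih =>
    rw [iter, traj, step_eq_stepFin, ih]
    rfl

theorem halves_iff {m d : ℕ} (f : Fin m → Vec d → ℝ) (S₁ S₂ : ℕ) (x₁ xs : Vec d)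
    (k : ℕ → ℕ → ℕ → Fin m) (n : ℕ) :
    Halves (stepFin f S₁ S₂) x₁ (fun x => ‖x - xs‖) n (fun t i j => k t i j) ↔
      ∀ t < n, ‖iter f S₁ S₂ x₁ k (t + 1) - xs‖ ≤ ‖iter f S₁ S₂ x₁ k t - xs‖ / 2 := by
  induction n with
  | zero => simp [Halves]
  | succ n ih =>
    rw [Halves, Nat.forall_lt_succ_right, ← ih, iter_eq_traj, iter_eq_traj]
    rfl

/-- One step from a point near the minimizer reduces a high moment of the distance. -/
theorem mean_pow_stepFin_le_of_near {m d : ℕ} (hm : 1 ≤ m) (hd : 1 ≤ d) {f : Fin m → Vec d → ℝ}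
    {M : ℝ} {xs : Vec d} (hf : ∀ k, ContDiff ℝ 2 (f k)) (h1 : ∀ k x, hess (f k) x ≤ 1)
    (hM0 : 0 ≤ M) (hM : ∀ x y, ‖hess (avg f) x - hess (avg f) y‖ ≤ M * ‖x - y‖)
    (hpos : ∀ x, 0 < alphaMin f x) (hbdd : BddAbove (Set.range fun x => 1 / alphaMin f x))
    (hmin : ∀ y, avg f xs ≤ avg f y) {δ : ℝ} {S₁ S₂ : ℕ} (hδ : 0 < δ) (hδd : 2 * δ ≤ d)
    (hS₁ : 2000 * kappaLocalMax f ^ 2 * Real.log (d / δ) ≤ S₁) (hS₁1 : 1 ≤ S₁)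
    (hS₂ : 2 * kappaLocal f * Real.log (4 * kappaLocal f) ≤ S₂) {x : Vec d}
    (hx : 4 * kappaLocal f * M * ‖x - xs‖ ≤ 1)
    (hp : 1 ≤ momentExponent (Real.log (d / δ))) :
    (mean fun b => (2 * ‖stepFin f S₁ S₂ x b - xs‖) ^ momentExponent (Real.log (d / δ))) ≤
      δ / 2 * ‖x - xs‖ ^ momentExponent (Real.log (d / δ)) := by
  obtain ⟨hκ, hκmax, hcurv⟩ := kappaLocal_spec hm hd hf h1 hpos hbdd
  have hκm : 1 ≤ kappaLocalMax f := hκ.trans hκmax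
  have hκ0 : 0 < kappaLocal f := by linarith
  have hκm0 : 0 < kappaLocalMax f := by linarith
  have hH1 := hess_avg_le_one hm hf h1
  have hcontr : ∀ y v, ‖v - hess (avg f) y v‖ ≤ (1 - 1 / kappaLocal f) * ‖v‖ := fun y =>
    norm_sub_apply_le (hH1 y) (hcurv y)
  have hcontr1 : ∀ y v, ‖v - hess (avg f) y v‖ ≤ ‖v‖ := fun y v =>
    (hcontr y v).trans (mul_le_of_le_one_left (norm_nonneg v) (by
      have : 0 ≤ 1 / kappaLocal f := by positivity
      linarith))
  have hHnorm : ∀ y v, ‖hess (avg f) y v‖ ≤ ‖v‖ := by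
    intro y v
    simpa using norm_le_of_inner_le (isSymmetric_of_le_one (hH1 y)) (q := 1)
      (fun v => le_trans (by positivity) (hcurv y v))
      (fun v => by simpa using inner_le_of_le_one (hH1 y) v) v
  have hg := norm_gradient_avg_le hf hmin hHnorm x
  refine (mean_pow_norm_stepFin_le (κ := kappaLocalMax f) hm hS₁1 hp (fun b => ?_) ?_).trans
    (mul_le_mul_of_nonneg_right (exp_moment_bound hδ hd hδd rfl hκm0 hS₁) (by positivity))
  · exact (norm_chainFin_le hκm (fun k => norm_sub_apply_le (h1 k x)
      (one_div_kappaLocalMax_mul_le h1 hpos hbdd k x)) S₂ b).trans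
      (mul_le_mul_of_nonneg_left hg hκm0.le)
  · refine (norm_sub_mean_chainFin_le hm hf hκ (hcontr x)
      (norm_hess_sub_gradient_avg_le hf hM0 hmin hM x) S₂).trans ?_
    -- The bias is at most `D/16` from the truncated recursion plus `D/4` from the curvature error,
    -- below the allowed `3D/8`.
    have h2 := mul_le_mul (pow_mul_le_one_div hκ hS₂)
      (norm_sub_gradient_avg_le hf hmin hcontr1 x) (norm_nonneg _) (by norm_num)
    have h3 : kappaLocal f * (M * ‖x - xs‖ * ‖x - xs‖) ≤ 1 / 4 * ‖x - xs‖ := by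
      have := mul_le_mul_of_nonneg_right hx (norm_nonneg (x - xs))
      linarith
    linarith [norm_nonneg (x - xs)]

/-- The factor `A ^ 2` comes from the product `S₁ * S₂`; `n` is the exponent of the cost of a pass,
`2` in general and `1` for a GLM. -/
theorem time_budget {t m d S₁ S₂ n : ℕ} {A κ κm L l : ℝ} (hA : 1 ≤ A)
    (h₁ : S₁ ≤ A * (κm ^ 2 * L)) (h₂ : S₂ ≤ A * (κ * l))
    (ht : t ≤ 200 * (m * d + S₁ * S₂ * d ^ n)) :
    (t : ℝ) ≤ 200 * A ^ 2 * (m * d + κm ^ 2 * κ * d ^ n * (L * l)) := by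
  have h3 : (S₁ : ℝ) * S₂ ≤ A * (κm ^ 2 * L) * (A * (κ * l)) :=
    mul_le_mul h₁ h₂ (by positivity) ((Nat.cast_nonneg S₁).trans h₁)
  have h4 : (t : ℝ) ≤ 200 * (m * d + S₁ * S₂ * d ^ n) := by exact_mod_cast ht
  have h5 : (S₁ : ℝ) * S₂ * d ^ n ≤ A * (κm ^ 2 * L) * (A * (κ * l)) * d ^ n :=
    mul_le_mul_of_nonneg_right h3 (by positivity)
  have h6 : (m : ℝ) * d ≤ A ^ 2 * (m * d) :=
    le_mul_of_one_le_left (by positivity) (one_le_pow₀ hA)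
  linarith

end LiSSA

theorem theorem3p1 :
    ∃ C : ℝ, 0 < C ∧ ∃ K : ℝ, 0 < K ∧
    ∃ (prog : LiSSA.Prog LiSSA.GeneralOracle) (progGLM : LiSSA.Prog LiSSA.GLMOracle),
    ∀ (m d : ℕ), 1 ≤ m → 1 ≤ d →
    ∀ (f : Fin m → LiSSA.Vec d → ℝ) (α β M : ℝ) (xs : LiSSA.Vec d),
      -- standing assumptions on the objective; `xs` is its minimizer
      (∀ k, ContDiff ℝ 2 (f k)) →
      0 < α → LiSSA.StronglyConvexSmooth α β (LiSSA.avg f) →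
      (∀ k x, LiSSA.hess (f k) x ≤ 1) →
      (∀ x y, ‖LiSSA.hess (LiSSA.avg f) x - LiSSA.hess (LiSSA.avg f) y‖ ≤ M * ‖x - y‖) →
      -- `κ̂_l^max` is finite
      (∀ x, 0 < LiSSA.alphaMin f x) → BddAbove (Set.range fun x => 1 / LiSSA.alphaMin f x) →
      (∀ y, LiSSA.avg f xs ≤ LiSSA.avg f y) →
    ∀ (δ : ℝ) (S₁ S₂ : ℕ), 0 < δ → δ < 1 → 2 * δ ≤ d →
      C * LiSSA.kappaLocalMax f ^ 2 * Real.log (d / δ) ≤ S₁ →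
      2 * LiSSA.kappaLocal f * Real.log (4 * LiSSA.kappaLocal f) ≤ S₂ →
    -- convergence of the Newton phase after the warm start
    (∀ (Ω : Type) [MeasurableSpace Ω] (P : Measure Ω) [IsProbabilityMeasure P]
        (k : ℕ → ℕ → ℕ → Ω → Fin m), LiSSA.IsUniformSampling P k →
      ∀ x₁ : LiSSA.Vec d, 4 * LiSSA.kappaLocal f * M * ‖x₁ - xs‖ ≤ 1 →
        (∀ t : ℕ, 1 - δ ≤ P.real {ω |
          ‖LiSSA.iter f S₁ S₂ x₁ (fun t i j => k t i j ω) (t + 1) - xs‖ ≤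
            ‖LiSSA.iter f S₁ S₂ x₁ (fun t i j => k t i j ω) t - xs‖ / 2}) ∧
        (∀ T : ℕ, (1 - δ) ^ T ≤ P.real {ω | ∀ t < T,
          ‖LiSSA.iter f S₁ S₂ x₁ (fun t i j => k t i j ω) (t + 1) - xs‖ ≤
            ‖LiSSA.iter f S₁ S₂ x₁ (fun t i j => k t i j ω) t - xs‖ / 2})) ∧
    -- running time of a step, for `S₁` and `S₂` within a factor `A` of their thresholds
    (∀ A : ℝ, 1 ≤ A →
      S₁ ≤ A * (LiSSA.kappaLocalMax f ^ 2 * Real.log (d / δ)) →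
      S₂ ≤ A * (LiSSA.kappaLocal f * Real.log (4 * LiSSA.kappaLocal f)) →
      ∀ (x : LiSSA.Vec d) (ω : ℕ → Fin m),
        LiSSA.StepDone f S₁ S₂ x ω
          (prog.run (LiSSA.generalOracle f) (fun n => ω n)
            (LiSSA.initState m S₁ S₂ x 0 0))
          (K * A ^ 2 * (m * d + LiSSA.kappaLocalMax f ^ 2 * LiSSA.kappaLocal f * d ^ 2 *
            (Real.log (d / δ) * Real.log (4 * LiSSA.kappaLocal f)))) ∧
        ∀ (ℓ : Fin m → ℝ → ℝ) (v : Fin m → LiSSA.Vec d) (lam : ℝ), LiSSA.IsGLM f ℓ v lam →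
          LiSSA.StepDone f S₁ S₂ x ω
            (progGLM.run (LiSSA.glmOracle ℓ) (fun n => ω n)
              (LiSSA.initState m S₁ S₂ x (LiSSA.glmData v) (fun n => if n = 0 then lam else 0)))
            (K * A ^ 2 * (m * d + LiSSA.kappaLocalMax f ^ 2 * LiSSA.kappaLocal f * d *
              (Real.log (d / δ) * Real.log (4 * LiSSA.kappaLocal f))))) := by
  open LiSSA in
  refine ⟨2000, by norm_num, 200, by norm_num, stepProg gradProg passProg,
    stepProg gradProgGLM passProgGLM, ?_⟩
  intro m d hm hd f α β M xs hf _ _ h1 hM hpos hbdd hmin δ S₁ S₂ hδ hδ1 hδd hS₁ hS₂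
  obtain ⟨hκ, hκmax, -⟩ := kappaLocal_spec hm hd hf h1 hpos hbdd
  have hκ0 : 0 < kappaLocal f := by linarith
  have hκm0 : 0 < kappaLocalMax f := by linarith
  have hL2 : Real.log 2 ≤ Real.log (d / δ) :=
    Real.log_le_log (by norm_num) ((le_div_iff₀ hδ).2 hδd)
  have hL0 : 0 < Real.log (d / δ) := (Real.log_pos (by norm_num)).trans_le hL2
  have hl0 : 0 < Real.log (4 * kappaLocal f) := Real.log_pos (by linarith)
  have hS₁1 : 1 ≤ S₁ := by
    have : (0 : ℝ) < S₁ := lt_of_lt_of_le (by positivity) hS₁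
    exact_mod_cast this
  have hS₂1 : 1 ≤ S₂ := by
    have : (0 : ℝ) < S₂ := lt_of_lt_of_le (by positivity) hS₂
    exact_mod_cast this
  have hdiff : ∀ k, Differentiable ℝ (f k) := fun k => (hf k).differentiable (by norm_num)
  refine ⟨?_, ?_⟩
  · intro Ω _ P _ k hk x₁ hx₁
    -- The Lipschitz bound is tested on two points at distance `1`, which exist because `d ≥ 1`.
    have hM0 : 0 ≤ M := by
      have h := (norm_nonneg _).trans (hM (EuclideanSpace.single ⟨0, hd⟩ 1) 0)
      simpa using h
    have hp := one_le_momentExponent hL2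
    have hq : 0 ≤ 4 * kappaLocal f * M := by positivity
    have hF : ∀ x : Vec d, 4 * kappaLocal f * M * ‖x - xs‖ ≤ 1 → _ := fun x hx =>
      mean_pow_stepFin_le_of_near hm hd hf h1 hM0 hM hpos hbdd hmin hδ hδd hS₁ hS₁1 hS₂ hx hp
    have : Nonempty (Fin m) := ⟨⟨0, hm⟩⟩
    refine ⟨fun t => ?_, fun T => ?_⟩
    · have h2 := one_sub_le_prob_halve (V := fun x => ‖x - xs‖) hq (fun x => norm_nonneg _) hp
        hδ.le hδ1.le hx₁ hF t
      rw [← measureReal_eq_prob hk] at h2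
      simp only [iter_eq_traj]
      exact h2
    · have h2 := pow_le_prob_halves (V := fun x => ‖x - xs‖) hq (fun x => norm_nonneg _) hp
        hδ.le hδ1.le hx₁ hF T
      rw [← measureReal_eq_prob hk] at h2
      simp only [← halves_iff]
      exact h2
  · intro A hA hA₁ hA₂ x ω
    refine ⟨⟨run_stepProg_general hdiff S₁ S₂ x 0 0 ω, ?_⟩, fun ℓ v lam hglm =>
      ⟨run_stepProg_glm hm hdiff hglm S₁ S₂ x ω, ?_⟩⟩
    · exact time_budget hA hA₁ hA₂ (time_general f x _ hm hd hS₁1 hS₂1)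
    · have ht := time_glm ℓ x (glmData v) (fun n => if n = 0 then lam else 0) (fun n => ω n)
        hm hd hS₁1 hS₂1
      simpa only [pow_one] using time_budget (n := 1) hA hA₁ hA₂ (ht.trans_eq (by rw [pow_one]))
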